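/- Let $d$ be a natural number and $\lambda>0$. Equip $\mathbb Z^d$ with the nearest-neighbour graph structure ($u\sim v$ iff $\|u-v\|_1=1$). For a finite graph $G$ put $Z_G=\sum_M\lambda^{|M|}$, the sum being over all matchings $M$ of $G$. A Gibbs measure of the monomer-dimer model with activity $\lambda$ on a graph $G=(V,E)$ is a probability measure on $\{0,1\}^E$ (identified with the law of a random set of edges $\mathbf M\subseteq E$, with the product $\sigma$-field) such that for every finite $F\subset E$ and $S\subseteq F$, the conditional probability of $\mathbf M\cap F=S$ given $\mathbf M\setminus F$ is almost surely $\lambda^{|S|}\big/\sum_T\lambda^{|T|}$ if $S$ is a matching none of whose edges shares a node with an edge of $\mathbf M\setminus F$, and $0$ otherwise; here $T$ ranges over all matchings $T\subseteq F$ none of whose edges shares a node with an edge of $\mathbf M\setminus F$. Write $0\notin\mathbf M$ for the event that no edge of $\mathbf M$ is incident to the origin. For $v,u\in\mathbb Z^d$ write $v\prec u$ iff there is $k$ with $v_k<u_k$ and $v_j=u_j$ for all $j>k$, and let $$\mathbb Z^d_{\prec0}=\{u:u\prec0\}\cup\{0\},\qquad \mathbb Z^d_{\prec0,\mathrm{even}}=\mathbb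 Z^d_{\prec0}\cup\Big\{u:0\prec u,\ \sum_i u_i\text{ odd}\Big\}.$$ Then on each of the subgraphs of $\mathbb Z^d$ induced by $\mathbb Z^d_{\prec0}$ and $\mathbb Z^d_{\prec0,\mathrm{even}}$ there is exactly one Gibbs measure, denoted $\mathbb P_{\mathbb Z^d_{\prec0}}$ and $\mathbb P_{\mathbb Z^d_{\prec0,\mathrm{even}}}$ respectively; the event $0\notin\mathbf M$ has positive probability under both; and the free energy $$\mathcal P(d,\lambda)=\lim_{n\to\infty}\frac{\log Z_{\Lambda_n}}{|\Lambda_n|}$$ exists and takes the same value for all sequences of finite sets $0\in\Lambda_0\subseteq\Lambda_1\subseteq\cdots\subset\mathbb Z^d$ such that every ball $\{v:\|v\|_1\le r\}$ is contained in $\Lambda_n$ for all large $n$ and $|\partial\Lambda_n|/|\Lambda_n|\to0$, where $Z_{\Lambda_n}$ is the partition function of the subgraph induced by $\Lambda_n$ and $\partial\Lambda_n=\{v\in\Lambda_n: v\text{ has a neighbour outside }\Lambda_n\}$. Moreover $$\mathcal P(d,\lambda)=-\log\mathbb P_{\mathbb Z^d_{\prec0}}(0\notin\mathbf M)=-\tfrac12\log\mathbb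 P_{\mathbb Z^d_{\prec0,\mathrm{even}}}(0\notin\mathbf M).$$ -/

import Mathlib

open Filter Topology MeasureTheory ProbabilityTheory

namespace MonomerDimer

/-! ### The lattice, the lexicographic order and the two cavity regions -/

/-- The `ℓ¹` norm on `ℤ^d`. -/
def l1norm {d : ℕ} (v : Fin d → ℤ) : ℤ := ∑ j, |v j|

/-- The lattice `ℤ^d`: `u` and `v` are adjacent iff `‖v - u‖₁ = 1`. -/
def lattice (d : ℕ) : SimpleGraph (Fin d → ℤ) where
  Adj u v := l1norm (v - u) = 1
  symm := ⟨fun u v h => by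
    simpa only [l1norm, Pi.sub_apply, abs_sub_comm] using h⟩
  loopless := ⟨fun v h => by simp [l1norm] at h⟩

/-- The lexicographic order on `ℤ^d`, the last coordinate being the most significant one:
`v ≺ u` iff for some `k` one has `v k < u k` and `v j = u j` for all `j > k`. -/
def Prec {d : ℕ} (v u : Fin d → ℤ) : Prop :=
  ∃ k : Fin d, v k < u k ∧ ∀ j : Fin d, k < j → v j = u j

/-- `ℤ^d_{≺0} = {u : u ≺ 0} ∪ {0}`. -/
def below (d : ℕ) : Set (Fin d → ℤ) := {u | Prec u 0} ∪ {0}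

/-- `ℤ^d_{≺0,even} = ℤ^d_{≺0} ∪ {u : 0 ≺ u and the sum of the coordinates of u is odd}`. -/
def belowEven (d : ℕ) : Set (Fin d → ℤ) := below d ∪ {u | Odd (∑ j, u j) ∧ Prec 0 u}

/-- The origin belongs to `ℤ^d_{≺0}`. -/
theorem zero_mem_below (d : ℕ) : (0 : Fin d → ℤ) ∈ below d := Or.inr rfl

/-- The origin belongs to `ℤ^d_{≺0,even}`. -/
theorem zero_mem_belowEven (d : ℕ) : (0 : Fin d → ℤ) ∈ belowEven d := Or.inl (zero_mem_below d)

/-! ### Matchings and the partition function of a finite graph -/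

/-- A set of edges of `G` is a matching if no two (distinct) edges in it share a node. Two edges
are adjacent in the line graph of `G` iff they are distinct and share a node. -/
def IsMatching {V : Type*} (G : SimpleGraph V) (M : Set G.edgeSet) : Prop :=
  ∀ e ∈ M, ∀ e' ∈ M, ¬ G.lineGraph.Adj e e'

open Classical in
/-- The partition function `Z_G = ∑_M λ^|M|` of a finite graph `G`, the sum being over all
matchings `M` of `G`. -/
noncomputable def partitionFunction {V : Type*} [Finite V] (G : SimpleGraph V) (lam : ℝ) : ℝ :=
  letI : Fintype G.edgeSet := Fintype.ofFinite _
  ∑ M : Finset G.edgeSet, if IsMatching G (M : Set G.edgeSet) then lam ^ M.card else 0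

/-! ### Gibbs measures on a (possibly infinite) graph -/

/-- Spin configurations: `σ e = true` means that the edge `e` belongs to the random matching `𝐌`
(spin `1`) and `σ e = false` that it does not (spin `0`). The space carries the product
`σ`-field. -/
abbrev Config {V : Type*} (G : SimpleGraph V) : Type _ := G.edgeSet → Bool

/-- The configuration which inside the finite set `F` of edges is given by `S ⊆ F` and outside `F`
by `σ` violates no hard-core constraint that involves an edge of `F`. -/
def Compatible {V : Type*} (G : SimpleGraph V) (F S : Finset G.edgeSet) (σ : Config G) : Prop :=
  IsMatching G (S : Set G.edgeSet) ∧
    ∀ e ∈ S, ∀ e' : G.edgeSet, e' ∉ F → σ e' = true → ¬ G.lineGraph.Adj e e'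

open Classical in
/-- The weight of `S ⊆ F` under the boundary condition `σ` outside `F`. -/
noncomputable def weight {V : Type*} (G : SimpleGraph V) (lam : ℝ) (F S : Finset G.edgeSet)
    (σ : Config G) : ℝ :=
  if Compatible G F S σ then lam ^ S.card else 0

/-- The finite-volume Gibbs distribution on the subsets `S` of the finite set `F` of edges, under
the boundary condition `σ` outside `F`. The denominator is at least `1` (take `T = ∅`). -/
noncomputable def finiteGibbs {V : Type*} (G : SimpleGraph V) (lam : ℝ) (F S : Finset G.edgeSet)
    (σ : Config G) : ℝ :=
  weight G lam F S σ / ∑ T ∈ F.powerset, weight G lam F T σ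

/-- `μ` is a Gibbs measure of the monomer-dimer model with activity `lam` on `G`: a probability
measure such that for every finite set `F` of edges the conditional distribution of the
configuration in `F`, given the configuration outside `F`, is the finite-volume Gibbs
distribution (spatial Markovian property). -/
structure IsGibbsMeasure {V : Type*} (G : SimpleGraph V) (lam : ℝ) (μ : Measure (Config G)) :
    Prop where
  isProbabilityMeasure : IsProbabilityMeasure μ
  condProb : ∀ F S : Finset G.edgeSet, S ⊆ F →
    μ⟦{σ : Config G | ∀ e ∈ F, (σ e = true ↔ e ∈ S)} | cylinderEvents (F : Set G.edgeSet)ᶜ⟧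
      =ᵐ[μ] fun σ => finiteGibbs G lam F S σ

/-- The event `v ∉ 𝐌`: the random matching contains no edge incident to the node `v`. -/
def unmatched {V : Type*} (G : SimpleGraph V) (v : V) : Set (Config G) :=
  {σ | ∀ e : G.edgeSet, v ∈ (e : Sym2 V) → σ e = false}

/-! ### The free energy -/

/-- The boundary `∂Λ = {v ∈ Λ : N(v) ∩ Λᶜ ≠ ∅}` of a finite subset `Λ` of the lattice. -/
def boundary {d : ℕ} (Λ : Finset (Fin d → ℤ)) : Set (Fin d → ℤ) :=
  {v | v ∈ Λ ∧ ∃ u, (lattice d).Adj v u ∧ u ∉ Λ}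

/-- Admissible sequences of finite regions: `0 ∈ Λ₀ ⊆ Λ₁ ⊆ ⋯`, every ball around the origin is
eventually contained in `Λₙ`, and `|∂Λₙ| / |Λₙ| → 0`. -/
structure IsExhaustion {d : ℕ} (Λ : ℕ → Finset (Fin d → ℤ)) : Prop where
  zero_mem : 0 ∈ Λ 0
  mono : Monotone Λ
  ball_subset : ∀ r : ℕ, ∀ᶠ n in atTop, ∀ v : Fin d → ℤ, l1norm v ≤ r → v ∈ Λ n
  boundary_small : Tendsto (fun n => ((boundary (Λ n)).ncard : ℝ) / (Λ n).card) atTop (𝓝 0)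

/-- `P` is the free energy (pressure) of the monomer-dimer model on `ℤ^d` with activity `lam`:
`log Z_{Λₙ} / |Λₙ|` converges to `P` along every admissible sequence of finite regions, where
`Z_{Λₙ}` is the partition function of the subgraph of the lattice induced by `Λₙ`. -/
def IsFreeEnergy (d : ℕ) (lam P : ℝ) : Prop :=
  ∀ Λ : ℕ → Finset (Fin d → ℤ), IsExhaustion Λ →
    Tendsto (fun n =>
      Real.log (partitionFunction ((lattice d).induce (Λ n : Set (Fin d → ℤ))) lam) / (Λ n).card)
      atTop (𝓝 P)

end MonomerDimer

/-! The proof is the cavity method. On a finite graph the ratio `Z_{G-v} / Z_G` is the probability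
that `v` is unmatched (`vacancy`), so removing nodes one at a time writes `log Z` as a sum of terms
`-log vacancy` (`log_matchingSum_telescope`). If the nodes of `Λ_n` are removed from the
lexicographically largest down, the graph present when `v` is removed is, seen from `v` and up to
the boundary of `Λ_n`, the graph induced by `below d`. If only the even nodes are removed, it is the
one induced by `belowEven d`; since the lattice is bipartite, the odd nodes left at the end span no
edge, and about half of all nodes are removed, whence the factor `1/2`.

Each vacancy may be replaced by its infinite-volume value because of correlation decay
(`vacancy_le_vacancy`). The recursion `p_v(G) = 1 / (1 + λ ∑_u p_u(G - v))`, over the neighbours `u`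
of `v`, contracts relative errors by the factor `λΔ / (1 + λΔ)`, so edges at distance `r` have
influence exponentially small in `r`, at every activity. Nodes near the boundary contribute bounded
terms and have vanishing density (`abs_log_matchingSum_add_le`).

Decay also gives uniqueness. The probability of avoiding a finite set of edges is built from
vacancies, hence is insensitive to distant boundary conditions (`isLocal_avoidance`), and these
probabilities determine the measure. Existence is compactness: a limit of finite-volume measures
inherits the Markov property (`exists_isGibbsMeasure`). -/

namespace MonomerDimer

/-! ### Finite partition functions, the vacancy recursion and correlation decay. -/

section MatchingSum

open scoped Classical

variable {V : Type*} {G : SimpleGraph V} {lam : ℝ}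

/-- The partition function of the finite set `F` of edges: the sum of `λ^|S|` over the
matchings `S ⊆ F`. -/
noncomputable def matchingSum (G : SimpleGraph V) (lam : ℝ) (F : Finset G.edgeSet) : ℝ :=
  ∑ S ∈ F.powerset, if IsMatching G (S : Set G.edgeSet) then lam ^ S.card else 0

/-- The edges of `F` that are not incident to `v`. -/
noncomputable def delVertex (F : Finset G.edgeSet) (v : V) : Finset G.edgeSet :=
  F.filter fun e => v ∉ (e : Sym2 V)

/-- The edges of `F` that are incident to `v`. -/
noncomputable def incident (F : Finset G.edgeSet) (v : V) : Finset G.edgeSet :=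
  F.filter fun e => v ∈ (e : Sym2 V)

/-- The edges of `F` that share no node with `e`. -/
noncomputable def prune (F : Finset G.edgeSet) (e : G.edgeSet) : Finset G.edgeSet :=
  F.filter fun e' => ∀ v ∈ (e : Sym2 V), v ∉ (e' : Sym2 V)

/-- The probability that `v` is unmatched in a random matching contained in `F`. -/
noncomputable def vacancy (G : SimpleGraph V) (lam : ℝ) (F : Finset G.edgeSet) (v : V) : ℝ :=
  matchingSum G lam (delVertex F v) / matchingSum G lam F

theorem mem_delVertex {F : Finset G.edgeSet} {v : V} {e : G.edgeSet} :
    e ∈ delVertex F v ↔ e ∈ F ∧ v ∉ (e : Sym2 V) := by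
  simp [delVertex]

theorem mem_incident {F : Finset G.edgeSet} {v : V} {e : G.edgeSet} :
    e ∈ incident F v ↔ e ∈ F ∧ v ∈ (e : Sym2 V) := by
  simp [incident]

theorem mem_prune {F : Finset G.edgeSet} {e e' : G.edgeSet} :
    e' ∈ prune F e ↔ e' ∈ F ∧ ∀ v ∈ (e : Sym2 V), v ∉ (e' : Sym2 V) := by
  simp [prune]

theorem isMatching_empty : IsMatching G ∅ := fun _ h => h.elim

theorem IsMatching.mono {S T : Set G.edgeSet} (h : IsMatching G T) (hST : S ⊆ T) :
    IsMatching G S := fun e he e' he' => h e (hST he) e' (hST he')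

theorem isMatching_insert {e : G.edgeSet} {S : Set G.edgeSet} :
    IsMatching G (insert e S) ↔ IsMatching G S ∧ ∀ e' ∈ S, ¬ G.lineGraph.Adj e e' := by
  constructor
  · intro h
    exact ⟨h.mono (Set.subset_insert _ _), fun e' he' =>
      h e (Set.mem_insert _ _) e' (Set.mem_insert_of_mem _ he')⟩
  · rintro ⟨h, h'⟩ a (rfl | ha) b (rfl | hb)
    · exact G.lineGraph.irrefl
    · exact h' b hb
    · exact fun hab => h' a ha hab.symm
    · exact h a ha b hb

theorem one_le_matchingSum (hlam : 0 < lam) (F : Finset G.edgeSet) :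
    1 ≤ matchingSum G lam F := by
  have h := Finset.single_le_sum (s := F.powerset)
    (f := fun S : Finset G.edgeSet => if IsMatching G (S : Set G.edgeSet) then lam ^ S.card else 0)
    (fun S _ => by split_ifs <;> positivity) (Finset.empty_mem_powerset F)
  simpa [matchingSum, isMatching_empty] using h

theorem matchingSum_pos (hlam : 0 < lam) (F : Finset G.edgeSet) : 0 < matchingSum G lam F :=
  one_pos.trans_le (one_le_matchingSum hlam F)

theorem matchingSum_mono (hlam : 0 < lam) {F F' : Finset G.edgeSet} (h : F ⊆ F') :
    matchingSum G lam F ≤ matchingSum G lam F' :=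
  Finset.sum_le_sum_of_subset_of_nonneg (Finset.powerset_mono.2 h)
    fun S _ _ => by split_ifs <;> positivity

theorem matchingSum_empty : matchingSum G lam ∅ = 1 := by
  simp [matchingSum, isMatching_empty]

/-- Edge recursion for the partition function. -/
theorem matchingSum_insert {e : G.edgeSet} {F : Finset G.edgeSet} (he : e ∉ F) :
    matchingSum G lam (insert e F) =
      matchingSum G lam F + lam * matchingSum G lam (prune F e) := by
  rw [matchingSum, Finset.sum_powerset_insert he, ← matchingSum]
  congr 1
  rw [matchingSum, Finset.mul_sum]
  -- Matchings containing `e` are `e` together with a matching among the edges disjoint from `e`.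
  have key : ∀ S ∈ F.powerset, (∀ e' ∈ (S : Set G.edgeSet), ¬ G.lineGraph.Adj e e') ↔
      S ∈ (prune F e).powerset := by
    intro S hS
    rw [Finset.mem_powerset] at hS ⊢
    refine forall₂_congr fun e' he' => ?_
    have hne : e ≠ e' := fun h => he (h ▸ hS he')
    rw [SimpleGraph.lineGraph_adj_iff_exists, mem_prune]
    have := hS he'
    grind
  symm
  have hsub : (prune F e).powerset ⊆ F.powerset :=
    Finset.powerset_mono.2 (Finset.filter_subset _ _)
  rw [← Finset.sum_subset hsub]
  · refine Finset.sum_congr rfl fun S hS => ?_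
    have hSF := hsub hS
    have heS : e ∉ S := fun h => he (Finset.mem_powerset.1 hSF h)
    rw [Finset.coe_insert, isMatching_insert, Finset.card_insert_of_notMem heS]
    simp only [and_iff_left ((key S hSF).2 hS), mul_ite, mul_zero, pow_succ']
  · intro S hS hS'
    rw [Finset.coe_insert, isMatching_insert, if_neg]
    exact fun h => hS' ((key S hS).1 h.2)

theorem prune_eq_delVertex {e : G.edgeSet} {u v : V} (h : (e : Sym2 V) = s(u, v))
    (F : Finset G.edgeSet) : prune F e = delVertex (delVertex F u) v := by
  ext e'
  simp only [mem_prune, mem_delVertex, h, Sym2.mem_iff]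
  grind

/-- Vertex recursion for the partition function. -/
theorem matchingSum_eq_delVertex_add (F : Finset G.edgeSet) (v : V) :
    matchingSum G lam F = matchingSum G lam (delVertex F v) +
      lam * ∑ e ∈ incident F v,
        matchingSum G lam (prune (delVertex F v) e) := by
  -- The edges at `v` are added back one by one. Pruning by an edge at `v` deletes all those added
  -- before, so each step contributes a term independent of `T`.
  suffices h : ∀ T : Finset G.edgeSet, (∀ e ∈ T, v ∈ (e : Sym2 V)) →
      matchingSum G lam (T ∪ delVertex F v) = matchingSum G lam (delVertex F v) +
        lam * ∑ e ∈ T, matchingSum G lam (prune (delVertex F v) e) by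
    rw [← h _ fun e he => (mem_incident.1 he).2]
    congr 1
    exact (Finset.filter_union_filter_not_eq _ _).symm
  intro T
  induction T using Finset.induction_on with
  | empty => simp
  | insert e T he ih =>
    intro hT
    have hev := hT e (Finset.mem_insert_self _ _)
    rw [Finset.insert_union, matchingSum_insert, ih fun e' he' => hT e' (Finset.mem_insert_of_mem he'),
      Finset.sum_insert he]
    · have : prune (T ∪ delVertex F v) e = prune (delVertex F v) e := by
        ext e'
        simp only [mem_prune, Finset.mem_union]
        have := hT e'
        grind
      rw [this]
      ring
    · simp [he, mem_delVertex, hev]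

theorem vacancy_pos (hlam : 0 < lam) (F : Finset G.edgeSet) (v : V) :
    0 < vacancy G lam F v :=
  div_pos (matchingSum_pos hlam _) (matchingSum_pos hlam _)

theorem vacancy_le_one (hlam : 0 < lam) (F : Finset G.edgeSet) (v : V) :
    vacancy G lam F v ≤ 1 :=
  div_le_one_of_le₀ (matchingSum_mono hlam (Finset.filter_subset _ _)) (matchingSum_pos hlam _).le

/-- The vacancy recursion of the cavity method. -/
theorem vacancy_recursion (hlam : 0 < lam) (F : Finset G.edgeSet) (v : V) :
    vacancy G lam F v = (1 + lam * ∑ e ∈ incident F v,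
      matchingSum G lam (prune (delVertex F v) e) / matchingSum G lam (delVertex F v))⁻¹ := by
  have h := matchingSum_pos hlam (delVertex F v)
  rw [vacancy, matchingSum_eq_delVertex_add F v, ← Finset.sum_div]
  field_simp

/-- Identifies the terms of `vacancy_recursion` as vacancies of the neighbours once `v` is gone. The
recursion itself uses `prune` so that it can be summed over edges without choosing their other end.
-/
theorem prune_ratio {e : G.edgeSet} {u v : V} (h : (e : Sym2 V) = s(v, u))
    (F : Finset G.edgeSet) :
    matchingSum G lam (prune (delVertex F v) e) / matchingSum G lam (delVertex F v) =
      vacancy G lam (delVertex F v) u := by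
  have : prune (delVertex F v) e = delVertex (delVertex F v) u := by
    rw [prune_eq_delVertex h]
    ext; simp [mem_delVertex]
  rw [this, vacancy]

/-- The set of nodes at distance less than `r` from `v`. -/
def near (G : SimpleGraph V) : ℕ → V → Set V
  | 0, _ => ∅
  | r + 1, v => {v} ∪ ⋃ u ∈ G.neighborSet v, near G r u

/-- All nodes of `G` have degree at most `Δ`. -/
def DegreeLE (G : SimpleGraph V) (Δ : ℕ) : Prop :=
  ∀ v, {e : G.edgeSet | v ∈ (e : Sym2 V)}.encard ≤ Δ

theorem DegreeLE.card_filter_le {Δ : ℕ} (hΔ : DegreeLE G Δ) (F : Finset G.edgeSet) (v : V) :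
    (incident F v).card ≤ Δ := by
  have : (incident F v : Set G.edgeSet).encard ≤ Δ :=
    (Set.encard_le_encard fun e he => (mem_incident.1 he).2).trans (hΔ v)
  rw [Set.encard_coe_eq_coe_finsetCard] at this
  exact_mod_cast this

theorem DegreeLE.finite {Δ : ℕ} (hΔ : DegreeLE G Δ) (v : V) :
    {e : G.edgeSet | v ∈ (e : Sym2 V)}.Finite :=
  Set.finite_of_encard_le_coe (hΔ v)

theorem sum_prune_ratio_le (hlam : 0 < lam) {Δ : ℕ} (hΔ : DegreeLE G Δ)
    (F : Finset G.edgeSet) (v : V) :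
    ∑ e ∈ incident F v,
      matchingSum G lam (prune (delVertex F v) e) / matchingSum G lam (delVertex F v) ≤ Δ := by
  calc _ ≤ ∑ e ∈ incident F v, (1 : ℝ) := by
        refine Finset.sum_le_sum fun e he => ?_
        obtain ⟨u, hu⟩ := Sym2.mem_iff_exists.1 (mem_incident.1 he).2
        rw [prune_ratio hu]
        exact vacancy_le_one hlam _ _
    _ ≤ Δ := by
        rw [Finset.sum_const, nsmul_eq_mul, mul_one]
        exact_mod_cast hΔ.card_filter_le F v

theorem le_vacancy (hlam : 0 < lam) {Δ : ℕ} (hΔ : DegreeLE G Δ)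
    (F : Finset G.edgeSet) (v : V) : (1 + lam * Δ)⁻¹ ≤ vacancy G lam F v := by
  rw [vacancy_recursion hlam]
  have h0 : 0 ≤ ∑ e ∈ incident F v,
      matchingSum G lam (prune (delVertex F v) e) / matchingSum G lam (delVertex F v) :=
    Finset.sum_nonneg fun e _ => div_nonneg (matchingSum_pos hlam _).le (matchingSum_pos hlam _).le
  have := sum_prune_ratio_le hlam hΔ F v
  gcongr

/-- The rate at which the influence of the boundary at distance `r` decays. -/
noncomputable def decay (lam : ℝ) (Δ r : ℕ) : ℝ :=
  lam * Δ * (lam * Δ / (1 + lam * Δ)) ^ r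

theorem decay_nonneg (hlam : 0 < lam) (Δ r : ℕ) : 0 ≤ decay lam Δ r := by
  unfold decay; positivity

theorem tendsto_decay (hlam : 0 < lam) (Δ : ℕ) :
    Tendsto (decay lam Δ) atTop (𝓝 0) := by
  have h : Tendsto (fun r : ℕ => (lam * Δ / (1 + lam * Δ)) ^ r) atTop (𝓝 0) := by
    apply tendsto_pow_atTop_nhds_zero_of_lt_one (by positivity)
    rw [div_lt_one (by positivity)]
    linarith
  simpa using (h.const_mul (lam * Δ)).congr fun r => (rfl : _ = decay lam Δ r)

/-- **Correlation decay**: the vacancy of `v` hardly depends on the edges far away from `v`. -/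
theorem vacancy_le_vacancy (hlam : 0 < lam) {Δ : ℕ} (hΔ : DegreeLE G Δ) (r : ℕ) :
    ∀ (F F' : Finset G.edgeSet) (v : V),
      (∀ e : G.edgeSet, ∀ w ∈ (e : Sym2 V), w ∈ near G r v → (e ∈ F ↔ e ∈ F')) →
      vacancy G lam F v ≤ (1 + decay lam Δ r) * vacancy G lam F' v := by
  have hK : 0 < 1 + lam * Δ := by positivity
  induction r with
  | zero =>
    intro F F' v _
    -- The prefactor in `decay` is such that at `r = 0` the bounds `(1 + λΔ)⁻¹ ≤ vacancy ≤ 1`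
    -- suffice.
    calc vacancy G lam F v ≤ 1 := vacancy_le_one hlam _ _
      _ = (1 + decay lam Δ 0) * (1 + lam * Δ)⁻¹ := by
        rw [decay, pow_zero, mul_one, mul_inv_cancel₀ hK.ne']
      _ ≤ _ := by
        have := decay_nonneg hlam Δ 0
        gcongr
        exact le_vacancy hlam hΔ F' v
  | succ r ih =>
    intro F F' v hF
    have hstar : incident F' v = incident F v := by
      ext e
      simp only [mem_incident, and_congr_left_iff]
      exact fun hv => (hF e v hv (Or.inl rfl)).symm
    have ha0 : 0 ≤ ∑ e ∈ incident F v,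
        matchingSum G lam (prune (delVertex F v) e) / matchingSum G lam (delVertex F v) :=
      Finset.sum_nonneg fun e _ =>
        div_nonneg (matchingSum_pos hlam _).le (matchingSum_pos hlam _).le
    have ha1 := sum_prune_ratio_le hlam hΔ F v
    have hb0 : 0 ≤ ∑ e ∈ incident F v,
        matchingSum G lam (prune (delVertex F' v) e) / matchingSum G lam (delVertex F' v) :=
      Finset.sum_nonneg fun e _ =>
        div_nonneg (matchingSum_pos hlam _).le (matchingSum_pos hlam _).le
    -- The recursion reverses order, so the induction hypothesis is used with `F` and `F'`
    -- exchanged.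
    have hba : ∑ e ∈ incident F v,
          matchingSum G lam (prune (delVertex F' v) e) / matchingSum G lam (delVertex F' v) ≤
        (1 + decay lam Δ r) * ∑ e ∈ incident F v,
          matchingSum G lam (prune (delVertex F v) e) / matchingSum G lam (delVertex F v) := by
      rw [Finset.mul_sum]
      refine Finset.sum_le_sum fun e he => ?_
      obtain ⟨u, hu⟩ := Sym2.mem_iff_exists.1 (mem_incident.1 he).2
      rw [prune_ratio hu, prune_ratio hu]
      refine ih _ _ u fun e' w hw hwu => ?_
      rw [mem_delVertex, mem_delVertex]
      have hadj : G.Adj v u := by rw [← SimpleGraph.mem_edgeSet, ← hu]; exact e.2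
      have := hF e' w hw (Or.inr (Set.mem_biUnion (show u ∈ G.neighborSet v from hadj) hwu))
      rw [this]
    rw [vacancy_recursion hlam, vacancy_recursion hlam F' v, hstar]
    set a := ∑ e ∈ incident F v,
      matchingSum G lam (prune (delVertex F v) e) / matchingSum G lam (delVertex F v)
    set b := ∑ e ∈ incident F v,
      matchingSum G lam (prune (delVertex F' v) e) / matchingSum G lam (delVertex F' v)
    rw [← div_eq_mul_inv, inv_eq_one_div, div_le_div_iff₀ (by positivity) (by positivity), one_mul]
    have hd : decay lam Δ (r + 1) * (1 + lam * Δ) = decay lam Δ r * (lam * Δ) := by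
      rw [decay, decay, pow_succ]
      field_simp
    have hd0 := decay_nonneg hlam Δ r
    -- The contraction: `t ↦ t / (1 + t)` is increasing, so `λa / (1 + λa) ≤ λΔ / (1 + λΔ)`.
    have h1 : decay lam Δ r * (lam * a) ≤ decay lam Δ (r + 1) * (1 + lam * a) := by
      refine le_of_mul_le_mul_right ?_ hK
      calc decay lam Δ r * (lam * a) * (1 + lam * Δ)
          ≤ decay lam Δ r * (lam * Δ * (1 + lam * a)) := by
            have h : lam * a ≤ lam * Δ := by gcongr
            have : lam * a * (1 + lam * Δ) ≤ lam * Δ * (1 + lam * a) := by linarith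
            rw [mul_assoc]
            gcongr
        _ = decay lam Δ (r + 1) * (1 + lam * a) * (1 + lam * Δ) := by
            linear_combination (-(1 + lam * a)) * hd
    have h2 : lam * b ≤ lam * ((1 + decay lam Δ r) * a) := by gcongr
    linarith
end MatchingSum

end MonomerDimer

namespace MonomerDimer

/-! ### Locality of avoidance probabilities. -/

section Locality

open scoped Classical

/-- A function of a finite set is local if, up to any `ε > 0`, it depends only on the
intersection with a fixed finite set. -/
def IsLocal {α : Type*} (Φ : Finset α → ℝ) : Prop :=
  ∀ ε > 0, ∃ B : Finset α, ∀ F F' : Finset α, (∀ e ∈ B, (e ∈ F ↔ e ∈ F')) → |Φ F - Φ F'| ≤ ε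

theorem isLocal_const {α : Type*} (c : ℝ) : IsLocal fun _ : Finset α => c :=
  fun ε hε => ⟨∅, fun _ _ _ => by simpa using hε.le⟩

theorem IsLocal.mul {α : Type*} {Φ Ψ : Finset α → ℝ} (hΦ : IsLocal Φ) (hΨ : IsLocal Ψ)
    (hΦ1 : ∀ F, |Φ F| ≤ 1) (hΨ1 : ∀ F, |Ψ F| ≤ 1) : IsLocal fun F => Φ F * Ψ F := by
  intro ε hε
  obtain ⟨B, hB⟩ := hΦ (ε / 2) (half_pos hε)
  obtain ⟨C, hC⟩ := hΨ (ε / 2) (half_pos hε)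
  refine ⟨B ∪ C, fun F F' h => ?_⟩
  have h1 := hB F F' fun e he => h e (Finset.mem_union_left _ he)
  have h2 := hC F F' fun e he => h e (Finset.mem_union_right _ he)
  calc |Φ F * Ψ F - Φ F' * Ψ F'| = |(Φ F - Φ F') * Ψ F + Φ F' * (Ψ F - Ψ F')| := by ring_nf
    _ ≤ |Φ F - Φ F'| * |Ψ F| + |Φ F'| * |Ψ F - Ψ F'| := by
      rw [← abs_mul, ← abs_mul]; exact abs_add_le _ _
    _ ≤ ε / 2 * 1 + 1 * (ε / 2) := by
      gcongr
      · exact hΨ1 F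
      · exact hΦ1 F'
    _ = ε := by ring

theorem IsLocal.one_sub_const_mul {α : Type*} {Φ : Finset α → ℝ} (hΦ : IsLocal Φ) {c : ℝ}
    (hc : 0 < c) : IsLocal fun F => 1 - c * Φ F := by
  intro ε hε
  obtain ⟨B, hB⟩ := hΦ (ε / c) (div_pos hε hc)
  refine ⟨B, fun F F' h => ?_⟩
  have h1 := hB F F' h
  rw [le_div_iff₀ hc] at h1
  calc |1 - c * Φ F - (1 - c * Φ F')| = |(Φ F - Φ F') * -c| := by ring_nf
    _ ≤ ε := by rwa [abs_mul, abs_neg, abs_of_pos hc]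

theorem IsLocal.comp {α : Type*} {Φ : Finset α → ℝ} (hΦ : IsLocal Φ) {g : Finset α → Finset α}
    (hg : ∀ F F' e, (e ∈ F ↔ e ∈ F') → (e ∈ g F ↔ e ∈ g F')) : IsLocal fun F => Φ (g F) := by
  intro ε hε
  obtain ⟨B, hB⟩ := hΦ ε hε
  exact ⟨B, fun F F' h => hB _ _ fun e he => hg F F' e (h e he)⟩

theorem isLocal_mem {α : Type*} [DecidableEq α] (a : α) :
    IsLocal fun F : Finset α => if a ∈ F then (1 : ℝ) else 0 := by
  refine fun ε hε => ⟨{a}, fun F F' h => ?_⟩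
  simp [h a (Finset.mem_singleton_self a), hε.le]

variable {V : Type*} {G : SimpleGraph V} {lam : ℝ} {Δ : ℕ}

theorem DegreeLE.finite_near (hΔ : DegreeLE G Δ) (r : ℕ) : ∀ v, (near G r v).Finite := by
  induction r with
  | zero => exact fun v => Set.finite_empty
  | succ r ih =>
    intro v
    have hfin : (G.neighborSet v).Finite := by
      have := ((hΔ.finite v).image fun e : G.edgeSet => (e : Sym2 V)).preimage
        (f := fun u => s(v, u)) (s := _) fun u _ w _ h => Sym2.congr_right.1 h
      refine this.subset fun u hu => ?_
      exact ⟨⟨s(v, u), hu⟩, by simp, rfl⟩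
    exact (Set.finite_singleton v).union (hfin.biUnion fun u _ => ih u)

theorem DegreeLE.exists_finset_near (hΔ : DegreeLE G Δ) (r : ℕ) (v : V) :
    ∃ B : Finset G.edgeSet, ∀ e : G.edgeSet, ∀ w ∈ (e : Sym2 V), w ∈ near G r v → e ∈ B := by
  have : (⋃ w ∈ near G r v, {e : G.edgeSet | w ∈ (e : Sym2 V)}).Finite :=
    (hΔ.finite_near r v).biUnion fun w _ => hΔ.finite w
  exact ⟨this.toFinset, fun e w hw hwv =>
    this.mem_toFinset.2 (Set.mem_biUnion hwv hw)⟩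

theorem abs_vacancy_le_one (hlam : 0 < lam) (F : Finset G.edgeSet) (v : V) :
    |vacancy G lam F v| ≤ 1 := by
  rw [abs_of_pos (vacancy_pos hlam F v)]
  exact vacancy_le_one hlam F v

theorem isLocal_vacancy (hlam : 0 < lam) (hΔ : DegreeLE G Δ) (v : V) :
    IsLocal fun F => vacancy G lam F v := by
  intro ε hε
  obtain ⟨r, hr⟩ := ((tendsto_decay hlam Δ).eventually (ge_mem_nhds hε)).exists
  obtain ⟨B, hB⟩ := hΔ.exists_finset_near r v
  refine ⟨B, fun F F' h => ?_⟩
  have key : ∀ F F' : Finset G.edgeSet, (∀ e ∈ B, (e ∈ F ↔ e ∈ F')) →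
      vacancy G lam F v - vacancy G lam F' v ≤ ε := by
    intro F F' h
    have h1 := vacancy_le_vacancy hlam hΔ r F F' v fun e w hw hwv => h e (hB e w hw hwv)
    have h2 := mul_le_mul_of_nonneg_left (vacancy_le_one hlam F' v) (decay_nonneg hlam Δ r)
    linarith
  rw [abs_le]
  have := key F' F fun e he => (h e he).symm
  exact ⟨by linarith, key F F' h⟩

/-- The probability that a random matching contained in `F` has no edge in `A`. -/
noncomputable def avoidance (G : SimpleGraph V) (lam : ℝ) (A F : Finset G.edgeSet) : ℝ :=
  matchingSum G lam (F \ A) / matchingSum G lam F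

theorem abs_avoidance_le_one (hlam : 0 < lam) (A F : Finset G.edgeSet) :
    |avoidance G lam A F| ≤ 1 := by
  rw [avoidance, abs_of_pos (div_pos (matchingSum_pos hlam _) (matchingSum_pos hlam _))]
  exact div_le_one_of_le₀ (matchingSum_mono hlam Finset.sdiff_subset) (matchingSum_pos hlam _).le

/-- For `e = uv` in `F`, the probability that `e` is used is `λ Z_{F-u-v} / Z_F`, that is, `λ` times
the vacancy of `u` in `F` times the vacancy of `v` in `F - u`. -/
theorem isLocal_avoidance_singleton (hlam : 0 < lam) (hΔ : DegreeLE G Δ) (e : G.edgeSet) :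
    IsLocal (avoidance G lam {e}) := by
  obtain ⟨⟨u, v⟩, he⟩ := e
  set e : G.edgeSet := ⟨s(u, v), he⟩
  have heq : avoidance G lam {e} = fun F => 1 - lam * ((if e ∈ F then (1 : ℝ) else 0) *
      (vacancy G lam F u * vacancy G lam (delVertex F u) v)) := by
    funext F
    by_cases hF : e ∈ F
    · have h1 := matchingSum_insert (lam := lam) (Finset.notMem_erase e F)
      rw [Finset.insert_erase hF, ← Finset.sdiff_singleton_eq_erase] at h1
      have h2 : prune (F \ {e}) e = delVertex (delVertex F u) v := by
        rw [prune_eq_delVertex (u := u) (v := v) rfl]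
        ext e'
        simp only [mem_delVertex, Finset.mem_sdiff, Finset.mem_singleton]
        have : e' = e → u ∈ (e' : Sym2 V) := by rintro rfl; simp [e]
        tauto
      have h3 := matchingSum_pos (G := G) hlam F
      have h4 := matchingSum_pos (G := G) hlam (delVertex F u)
      rw [avoidance, vacancy, vacancy, if_pos hF, one_mul, div_mul_div_cancel₀' h4.ne', ← h2]
      field_simp
      linarith
    · have := matchingSum_pos (G := G) hlam F
      simp [avoidance, Finset.sdiff_singleton_eq_erase, hF, this.ne']
  rw [heq]
  refine IsLocal.one_sub_const_mul ?_ hlam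
  refine (isLocal_mem e).mul ?_ (fun F => by split_ifs <;> simp) fun F => ?_
  · refine (isLocal_vacancy hlam hΔ u).mul ((isLocal_vacancy hlam hΔ v).comp ?_)
      (fun F => abs_vacancy_le_one hlam _ _) (fun F => abs_vacancy_le_one hlam _ _)
    intro F F' e h
    rw [mem_delVertex, mem_delVertex, h]
  · rw [abs_mul]
    exact mul_le_one₀ (abs_vacancy_le_one hlam _ _) (abs_nonneg _) (abs_vacancy_le_one hlam _ _)

/-- Chain rule: conditioning a random matching in `F` on avoiding `A` gives a random matching in `F
\ A`. -/
theorem isLocal_avoidance (hlam : 0 < lam) (hΔ : DegreeLE G Δ) (A : Finset G.edgeSet) :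
    IsLocal (avoidance G lam A) := by
  induction A using Finset.induction_on with
  | empty =>
    have : avoidance G lam ∅ = fun _ => 1 := by
      funext F
      simp [avoidance, (matchingSum_pos hlam F).ne']
    rw [this]
    exact isLocal_const 1
  | insert e A he ih =>
    have : avoidance G lam (insert e A) =
        fun F => avoidance G lam {e} (F \ A) * avoidance G lam A F := by
      funext F
      rw [avoidance, avoidance, avoidance, div_mul_div_cancel₀ (matchingSum_pos hlam _).ne',
        sdiff_sdiff, Finset.insert_eq, Finset.union_comm]
      rfl
    rw [this]
    refine ((isLocal_avoidance_singleton hlam hΔ e).comp ?_).mul ih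
      (fun F => abs_avoidance_le_one hlam _ _) (fun F => abs_avoidance_le_one hlam _ _)
    intro F F' e h
    rw [Finset.mem_sdiff, Finset.mem_sdiff, h]

end Locality

/-! ### Uniqueness of the Gibbs measure and finite-volume approximation. -/

section Uniqueness

open scoped Classical

variable {V : Type*} {G : SimpleGraph V} {lam : ℝ} {Δ : ℕ}

/-- The event that no edge of `A` belongs to the random matching. -/
def avoiding (A : Finset G.edgeSet) : Set (Config G) := {σ | ∀ e ∈ A, σ e = false}

/-- The event that the random matching coincides with `S` inside `F`. -/
def agreeing (F S : Finset G.edgeSet) : Set (Config G) := {σ | ∀ e ∈ F, (σ e = true ↔ e ∈ S)}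

/-- The edges of `F` that are not blocked by an edge of `σ` outside `F`. -/
noncomputable def allowed (F : Finset G.edgeSet) (σ : Config G) : Finset G.edgeSet :=
  F.filter fun e => ∀ e' : G.edgeSet, e' ∉ F → σ e' = true → ¬ G.lineGraph.Adj e e'

theorem weight_nonneg (hlam : 0 < lam) (F S : Finset G.edgeSet) (σ : Config G) :
    0 ≤ weight G lam F S σ := by
  unfold weight; split_ifs <;> positivity

/-- A boundary condition acts only by forbidding the edges of `F` that touch an outside edge of `σ`;
what remains is the free model on `allowed F σ`. This lets locality in the edge set control boundary
conditions. -/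
theorem sum_weight_eq (A F : Finset G.edgeSet) (σ : Config G) :
    ∑ S ∈ (F \ A).powerset, weight G lam F S σ = matchingSum G lam (allowed F σ \ A) := by
  have hsub : (allowed F σ \ A).powerset ⊆ (F \ A).powerset :=
    Finset.powerset_mono.2 (Finset.sdiff_subset_sdiff (Finset.filter_subset _ _) subset_rfl)
  rw [matchingSum, ← Finset.sum_subset hsub]
  · refine Finset.sum_congr rfl fun S hS => ?_
    have : Compatible G F S σ ↔ IsMatching G (S : Set G.edgeSet) := by
      refine ⟨fun h => h.1, fun h => ⟨h, fun e he => ?_⟩⟩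
      have := Finset.mem_powerset.1 hS he
      exact (Finset.mem_filter.1 (Finset.mem_sdiff.1 this).1).2
    rw [weight]
    simp only [this]
  · intro S hS hS'
    rw [weight, if_neg]
    intro h
    refine hS' (Finset.mem_powerset.2 fun e he => ?_)
    have := Finset.mem_sdiff.1 (Finset.mem_powerset.1 hS he)
    exact Finset.mem_sdiff.2 ⟨Finset.mem_filter.2 ⟨this.1, h.2 e he⟩, this.2⟩

theorem sum_finiteGibbs_eq (A F : Finset G.edgeSet) (σ : Config G) :
    ∑ S ∈ (F \ A).powerset, finiteGibbs G lam F S σ = avoidance G lam A (allowed F σ) := by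
  have := sum_weight_eq (lam := lam) ∅ F σ
  rw [Finset.sdiff_empty, Finset.sdiff_empty] at this
  simp only [finiteGibbs, this]
  rw [← Finset.sum_div, sum_weight_eq, avoidance]

theorem measurableSet_agreeing (F S : Finset G.edgeSet) : MeasurableSet (agreeing F S) := by
  have : agreeing F S = ⋂ e ∈ F, (fun σ : Config G => σ e) ⁻¹' {b | b = true ↔ e ∈ S} := by
    ext; simp [agreeing]
  rw [this]
  exact F.measurableSet_biInter fun e _ => measurable_pi_apply e (Set.toFinite _).measurableSet

theorem measurableSet_avoiding (A : Finset G.edgeSet) : MeasurableSet (avoiding A) := by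
  convert measurableSet_agreeing A ∅ using 1
  ext; simp [avoiding, agreeing]

theorem avoiding_eq_biUnion {A F : Finset G.edgeSet} (h : A ⊆ F) :
    avoiding A = ⋃ S ∈ (F \ A).powerset, agreeing F S := by
  ext σ
  simp only [avoiding, agreeing, Set.mem_ofPred_eq, Set.mem_iUnion, Finset.mem_powerset,
    exists_prop]
  constructor
  · intro hσ
    refine ⟨F.filter fun e => σ e = true, fun e he => ?_, fun e he => by simp [he]⟩
    rw [Finset.mem_filter] at he
    refine Finset.mem_sdiff.2 ⟨he.1, fun heA => ?_⟩
    simp [hσ e heA] at he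
  · rintro ⟨S, hS, hσ⟩ e he
    have := hσ e (h he)
    have h2 : e ∉ S := fun heS => (Finset.mem_sdiff.1 (hS heS)).2 he
    simpa [h2] using this

theorem IsGibbsMeasure.integrable_finiteGibbs {μ : Measure (Config G)}
    (hμ : IsGibbsMeasure G lam μ) {F S : Finset G.edgeSet} (hS : S ⊆ F) :
    Integrable (finiteGibbs G lam F S) μ :=
  integrable_condExp.congr (hμ.condProb F S hS)

theorem IsGibbsMeasure.measureReal_agreeing {μ : Measure (Config G)}
    (hμ : IsGibbsMeasure G lam μ) {F S : Finset G.edgeSet} (hS : S ⊆ F) :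
    μ.real (agreeing F S) = ∫ σ, finiteGibbs G lam F S σ ∂μ := by
  have := hμ.isProbabilityMeasure
  rw [← integral_congr_ae (hμ.condProb F S hS), integral_condExp cylinderEvents_le_pi]
  exact (integral_indicator_one (measurableSet_agreeing F S)).symm

/-- The Markov property integrated over the outside configuration, after splitting `avoiding A` by
the configuration inside `F`. -/
theorem IsGibbsMeasure.measureReal_avoiding {μ : Measure (Config G)}
    (hμ : IsGibbsMeasure G lam μ) {A F : Finset G.edgeSet} (hA : A ⊆ F) :
    Integrable (fun σ => avoidance G lam A (allowed F σ)) μ ∧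
    μ.real (avoiding A) = ∫ σ, avoidance G lam A (allowed F σ) ∂μ := by
  have := hμ.isProbabilityMeasure
  have hS : ∀ S ∈ (F \ A).powerset, S ⊆ F := fun S hS =>
    (Finset.mem_powerset.1 hS).trans Finset.sdiff_subset
  simp_rw [← sum_finiteGibbs_eq]
  refine ⟨integrable_finsetSum _ fun S h => hμ.integrable_finiteGibbs (hS S h), ?_⟩
  rw [integral_finsetSum _ fun S h => hμ.integrable_finiteGibbs (hS S h),
    avoiding_eq_biUnion hA, measureReal_biUnion_finset]
  · exact Finset.sum_congr rfl fun S h => hμ.measureReal_agreeing (hS S h)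
  · intro S hS1 T hT hST
    refine Set.disjoint_left.2 fun σ hσS hσT => hST ?_
    ext e
    by_cases he : e ∈ F
    · exact (hσS e he).symm.trans (hσT e he)
    · exact iff_of_false (fun h => he (hS S hS1 h)) (fun h => he (hS T hT h))
  · exact fun S _ => measurableSet_agreeing F S

theorem DegreeLE.exists_finset_adj (hΔ : DegreeLE G Δ) (B : Finset G.edgeSet) :
    ∃ C : Finset G.edgeSet, B ⊆ C ∧ ∀ e ∈ B, ∀ e', G.lineGraph.Adj e e' → e' ∈ C := by
  have hfin : (⋃ e ∈ B, ⋃ v ∈ {v | v ∈ (e : Sym2 V)},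
      {e' : G.edgeSet | v ∈ (e' : Sym2 V)}).Finite := by
    refine B.finite_toSet.biUnion fun e _ => Set.Finite.biUnion ?_ fun v _ => hΔ.finite v
    obtain ⟨⟨u, v⟩, he⟩ := e
    refine (Set.toFinite {u, v}).subset fun w hw => ?_
    simpa using hw
  refine ⟨B ∪ hfin.toFinset, Finset.subset_union_left, fun e he e' hadj => ?_⟩
  obtain ⟨-, v, hv, hv'⟩ := SimpleGraph.lineGraph_adj_iff_exists.1 hadj
  refine Finset.mem_union_right _ (hfin.mem_toFinset.2 ?_)
  simp only [Set.mem_iUnion]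
  exact ⟨e, he, v, hv, hv'⟩

/-- The probability under a Gibbs measure that the edges of `A` are avoided is the limit of the
corresponding probabilities in finite volume. -/
theorem IsGibbsMeasure.tendsto_avoidance (hlam : 0 < lam) (hΔ : DegreeLE G Δ)
    {μ : Measure (Config G)} (hμ : IsGibbsMeasure G lam μ) (A : Finset G.edgeSet) :
    Tendsto (avoidance G lam A) atTop (𝓝 (μ.real (avoiding A))) := by
  have := hμ.isProbabilityMeasure
  rw [Metric.tendsto_nhds]
  intro ε hε
  obtain ⟨B, hB⟩ := isLocal_avoidance hlam hΔ A (ε / 2) (half_pos hε)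
  obtain ⟨C, hBC, hC⟩ := hΔ.exists_finset_adj B
  filter_upwards [eventually_ge_atTop (A ∪ C)] with F hF
  obtain ⟨hint, hreal⟩ := hμ.measureReal_avoiding (Finset.union_subset_left hF)
  have hCF := Finset.union_subset_right hF
  have hclose : ∀ σ, ‖avoidance G lam A F - avoidance G lam A (allowed F σ)‖ ≤ ε / 2 := by
    refine fun σ => hB _ _ fun e he => ?_
    have heF := hCF (hBC he)
    -- All edges adjacent to `B` lie in `F`, so no edge of `B` can be blocked from outside: `F` and
    -- `allowed F σ` agree on `B`.
    refine iff_of_true heF (Finset.mem_filter.2 ⟨heF, fun e' he' _ hadj => he' ?_⟩)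
    exact hCF (hC e he e' hadj)
  have h1 : avoidance G lam A F - μ.real (avoiding A) =
      ∫ σ, (avoidance G lam A F - avoidance G lam A (allowed F σ)) ∂μ := by
    rw [integral_sub (integrable_const _) hint, hreal]
    simp
  rw [Real.dist_eq, h1, ← Real.norm_eq_abs]
  refine lt_of_le_of_lt ?_ (half_lt_self hε)
  simpa using norm_integral_le_of_norm_le_const (μ := μ) (ae_of_all _ hclose)

/-- Avoidance events are closed under intersection and generate the σ-field, so they alone determine
a measure. A general `s` is allowed because existence needs the events outside a finite `F`. -/
theorem isPiSystem_avoiding (s : Set G.edgeSet) :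
    IsPiSystem {t | ∃ A : Finset G.edgeSet, (A : Set G.edgeSet) ⊆ s ∧ avoiding A = t} := by
  rintro _ ⟨A, hA, rfl⟩ _ ⟨B, hB, rfl⟩ _
  refine ⟨A ∪ B, by simp [hA, hB], ?_⟩
  ext σ
  simp only [avoiding, Finset.mem_union, Set.mem_inter_iff, Set.mem_ofPred_eq]
  grind

theorem cylinderEvents_eq_generateFrom (s : Set G.edgeSet) :
    cylinderEvents (X := fun _ : G.edgeSet => Bool) s = MeasurableSpace.generateFrom
      {t | ∃ A : Finset G.edgeSet, (A : Set G.edgeSet) ⊆ s ∧ avoiding A = t} := by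
  apply le_antisymm
  · refine iSup₂_le fun e he => ?_
    rw [← measurable_iff_comap_le]
    refine @measurable_to_bool _ (MeasurableSpace.generateFrom _) _ ?_
    have : (fun σ : Config G => σ e) ⁻¹' {true} = (avoiding {e})ᶜ := by
      ext σ; simp [avoiding]
    rw [this]
    refine MeasurableSet.compl (MeasurableSpace.measurableSet_generateFrom ⟨{e}, by simpa, rfl⟩)
  · refine MeasurableSpace.generateFrom_le ?_
    rintro _ ⟨A, hA, rfl⟩
    have : avoiding A = ⋂ e ∈ A, (fun σ : Config G => σ e) ⁻¹' {false} := by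
      ext; simp [avoiding]
    rw [this]
    exact A.measurableSet_biInter fun e he =>
      measurable_cylinderEvent_apply (hA he) (measurableSet_singleton _)

/-- On a graph of bounded degree there is at most one Gibbs measure. -/
theorem IsGibbsMeasure.unique (hlam : 0 < lam) (hΔ : DegreeLE G Δ) {μ ν : Measure (Config G)}
    (hμ : IsGibbsMeasure G lam μ) (hν : IsGibbsMeasure G lam ν) : μ = ν := by
  have := hμ.isProbabilityMeasure
  have := hν.isProbabilityMeasure
  refine ext_of_generate_finite _
    (cylinderEvents_univ.symm.trans (cylinderEvents_eq_generateFrom Set.univ))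
    (isPiSystem_avoiding _) ?_ (by simp)
  rintro _ ⟨A, -, rfl⟩
  rw [← ENNReal.toReal_eq_toReal_iff' (measure_ne_top _ _) (measure_ne_top _ _)]
  exact tendsto_nhds_unique (hμ.tendsto_avoidance hlam hΔ A) (hν.tendsto_avoidance hlam hΔ A)

/-- The probability under a Gibbs measure that `v` is unmatched is the limit of the
corresponding probabilities in finite volume. -/
theorem IsGibbsMeasure.tendsto_vacancy (hlam : 0 < lam) (hΔ : DegreeLE G Δ)
    {μ : Measure (Config G)} (hμ : IsGibbsMeasure G lam μ) (v : V) :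
    Tendsto (fun F => vacancy G lam F v) atTop (𝓝 (μ.real (unmatched G v))) := by
  have h := hμ.tendsto_avoidance hlam hΔ (hΔ.finite v).toFinset
  have h1 : avoiding (hΔ.finite v).toFinset = unmatched G v := by
    ext σ; simp [avoiding, unmatched]
  rw [h1] at h
  refine h.congr fun F => ?_
  rw [avoidance, vacancy]
  congr 2
  ext e
  simp [mem_delVertex]

theorem IsGibbsMeasure.le_measureReal_unmatched (hlam : 0 < lam) (hΔ : DegreeLE G Δ)
    {μ : Measure (Config G)} (hμ : IsGibbsMeasure G lam μ) (v : V) :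
    (1 + lam * Δ)⁻¹ ≤ μ.real (unmatched G v) :=
  ge_of_tendsto' (hμ.tendsto_vacancy hlam hΔ v) fun F => le_vacancy hlam hΔ F v

/-- Every `F' ⊇ F` agrees with `F` near `v`, so correlation decay passes to the limit in `F'`; then
`log (1 + δ) ≤ δ` makes the relative error additive. -/
theorem IsGibbsMeasure.abs_log_vacancy_sub_le (hlam : 0 < lam) (hΔ : DegreeLE G Δ)
    {μ : Measure (Config G)} (hμ : IsGibbsMeasure G lam μ) (v : V) (r : ℕ)
    (F : Finset G.edgeSet)
    (hF : ∀ e : G.edgeSet, ∀ w ∈ (e : Sym2 V), w ∈ near G r v → e ∈ F) :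
    |Real.log (vacancy G lam F v) - Real.log (μ.real (unmatched G v))| ≤ decay lam Δ r := by
  have hd := decay_nonneg hlam Δ r
  have hm : 0 < μ.real (unmatched G v) :=
    lt_of_lt_of_le (by positivity) (hμ.le_measureReal_unmatched hlam hΔ v)
  have hp := vacancy_pos hlam F v
  have hlim := hμ.tendsto_vacancy hlam hΔ v
  have hlog : ∀ {x y : ℝ}, 0 < x → 0 < y → x ≤ (1 + decay lam Δ r) * y →
      Real.log x - Real.log y ≤ decay lam Δ r := by
    intro x y hx hy hxy
    have h1 := Real.log_le_log hx hxy
    rw [Real.log_mul (by positivity) hy.ne'] at h1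
    have := Real.log_le_sub_one_of_pos (show 0 < 1 + decay lam Δ r by positivity)
    linarith
  have h1 : vacancy G lam F v ≤ (1 + decay lam Δ r) * μ.real (unmatched G v) := by
    refine ge_of_tendsto (hlim.const_mul (1 + decay lam Δ r)) ?_
    filter_upwards [eventually_ge_atTop F] with F' hF'
    exact vacancy_le_vacancy hlam hΔ r F F' v fun e w hw hwv =>
      iff_of_true (hF e w hw hwv) (hF' (hF e w hw hwv))
  have h2 : μ.real (unmatched G v) ≤ (1 + decay lam Δ r) * vacancy G lam F v := by
    refine le_of_tendsto hlim ?_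
    filter_upwards [eventually_ge_atTop F] with F' hF'
    exact vacancy_le_vacancy hlam hΔ r F' F v fun e w hw hwv =>
      iff_of_true (hF' (hF e w hw hwv)) (hF e w hw hwv)
  rw [abs_le]
  have := hlog hm hp h2
  exact ⟨by linarith, hlog hp hm h1⟩

end Uniqueness

end MonomerDimer

namespace MonomerDimer

/-! ### Existence of a Gibbs measure by compactness. -/

section Existence

open scoped Classical

variable {V : Type*} {G : SimpleGraph V} {lam : ℝ} {Δ : ℕ}

/-- The configuration of the finite set `M` of edges. -/
noncomputable def configOf (M : Finset G.edgeSet) : Config G := fun e => decide (e ∈ M)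

theorem configOf_eq_true {M : Finset G.edgeSet} {e : G.edgeSet} :
    configOf M e = true ↔ e ∈ M := by
  simp [configOf]

/-- Only outside edges adjacent to `F` matter. With bounded degree there are finitely many, which
gives both continuity and measurability with respect to the outside of `F`. -/
theorem finiteGibbs_congr {F S : Finset G.edgeSet} {σ τ : Config G}
    (h : ∀ e ∉ F, (∃ e' ∈ F, G.lineGraph.Adj e' e) → σ e = τ e) (hS : S ⊆ F) :
    finiteGibbs G lam F S σ = finiteGibbs G lam F S τ := by
  have hw : ∀ T ⊆ F, weight G lam F T σ = weight G lam F T τ := by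
    intro T hT
    have : Compatible G F T σ ↔ Compatible G F T τ := by
      refine and_congr_right fun _ => forall₂_congr fun e he => forall₂_congr fun e' he' => ?_
      by_cases hadj : G.lineGraph.Adj e e'
      · rw [h e' he' ⟨e, hT he, hadj⟩]
      · simp [hadj]
    simp only [weight, this]
  rw [finiteGibbs, finiteGibbs, hw S hS,
    Finset.sum_congr rfl fun T hT => hw T (Finset.mem_powerset.1 hT)]

theorem sum_weight_pos (hlam : 0 < lam) (F : Finset G.edgeSet) (σ : Config G) :
    0 < ∑ T ∈ F.powerset, weight G lam F T σ := by
  have := sum_weight_eq (lam := lam) ∅ F σ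
  rw [Finset.sdiff_empty, Finset.sdiff_empty] at this
  rw [this]
  exact matchingSum_pos hlam _

theorem isMatching_union_iff {F R T : Finset G.edgeSet} (hR : Disjoint R F) :
    IsMatching G ((R ∪ T : Finset G.edgeSet) : Set G.edgeSet) ↔
      IsMatching G (R : Set G.edgeSet) ∧ Compatible G F T (configOf R) := by
  constructor
  · refine fun h => ⟨h.mono (by simp), h.mono (by simp), fun e he e' _ he' => ?_⟩
    exact h e (by simp [he]) e' (by simp [configOf_eq_true.1 he'])
  · rintro ⟨h1, h2, h3⟩ e he e' he'
    have hRF : ∀ e ∈ R, e ∉ F := fun e he => Finset.disjoint_left.1 hR he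
    rw [Finset.mem_coe, Finset.mem_union] at he he'
    rcases he with he | he <;> rcases he' with he' | he'
    · exact h1 e he e' he'
    · exact fun hadj => h3 e' he' e (hRF e he) (configOf_eq_true.2 he) hadj.symm
    · exact h3 e he e' (hRF e' he') (configOf_eq_true.2 he')
    · exact h2 e he e' he'

/-- The Gibbs distribution on matchings contained in a finite set of edges satisfies the
spatial Markov property, tested against functions of the configuration outside `F`. -/
theorem sum_matching_markov (hlam : 0 < lam) {F F' S : Finset G.edgeSet} (hF : F ⊆ F')
    (hS : S ⊆ F) (φ : Finset G.edgeSet → ℝ) :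
    ∑ M ∈ F'.powerset, (if IsMatching G (M : Set G.edgeSet) then lam ^ M.card else 0) *
      (φ (M \ F) * (finiteGibbs G lam F S (configOf M) - if M ∩ F = S then 1 else 0)) = 0 := by
  -- A matching is split as `M = (M \ F) ∪ (M ∩ F)`, and the sum over the inner part vanishes for
  -- each fixed outer part `R`.
  rw [Finset.sum_nbij' (s := F'.powerset) (t := (F' \ F).powerset ×ˢ F.powerset)
    (fun M => (M \ F, M ∩ F)) (fun p => p.1 ∪ p.2)
    (g := fun p => (if IsMatching G ((p.1 ∪ p.2 : Finset G.edgeSet) : Set G.edgeSet)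
      then lam ^ (p.1 ∪ p.2).card else 0) * (φ p.1 *
        (finiteGibbs G lam F S (configOf (p.1 ∪ p.2)) - if p.2 = S then 1 else 0)))]
  · rw [Finset.sum_product]
    refine Finset.sum_eq_zero fun R hR => ?_
    have hRF : Disjoint R F :=
      Finset.disjoint_of_subset_left (Finset.mem_powerset.1 hR) Finset.sdiff_disjoint
    -- The weight of `R ∪ T` factors into a term in `R` and the conditional weight of `T`; summing
    -- over `T` then gives zero by the definition of `finiteGibbs`.
    have hterm : ∀ T ∈ F.powerset,
        (if IsMatching G ((R ∪ T : Finset G.edgeSet) : Set G.edgeSet)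
          then lam ^ (R ∪ T).card else 0) * (φ R *
          (finiteGibbs G lam F S (configOf (R ∪ T)) - if T = S then 1 else 0)) =
        ((if IsMatching G (R : Set G.edgeSet) then lam ^ R.card else 0) * φ R) *
          (weight G lam F T (configOf R) * finiteGibbs G lam F S (configOf R) -
            if T = S then weight G lam F T (configOf R) else 0) := by
      intro T hT
      rw [Finset.mem_powerset] at hT
      have h1 : finiteGibbs G lam F S (configOf (R ∪ T)) = finiteGibbs G lam F S (configOf R) := by
        refine finiteGibbs_congr (fun e he _ => ?_) hS
        have : e ∉ T := fun h => he (hT h)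
        simp [configOf, this]
      have hcard : (R ∪ T).card = R.card + T.card :=
        Finset.card_union_of_disjoint (Finset.disjoint_of_subset_right hT hRF)
      simp only [h1, isMatching_union_iff hRF, hcard, weight, pow_add]
      split_ifs <;> first | tauto | ring
    rw [Finset.sum_congr rfl hterm, ← Finset.mul_sum, Finset.sum_sub_distrib, ← Finset.sum_mul,
      Finset.sum_ite_eq' F.powerset S, if_pos (Finset.mem_powerset.2 hS), finiteGibbs,
      mul_div_cancel₀ _ (sum_weight_pos hlam F _).ne', sub_self, mul_zero]
  · intro M hM
    rw [Finset.mem_powerset] at hM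
    simp only [Finset.mem_product, Finset.mem_powerset]
    exact ⟨Finset.sdiff_subset_sdiff hM subset_rfl, Finset.inter_subset_right⟩
  · intro p hp
    simp only [Finset.mem_product, Finset.mem_powerset] at hp ⊢
    exact Finset.union_subset (hp.1.trans Finset.sdiff_subset) (hp.2.trans hF)
  · intro M _
    exact Finset.sdiff_union_inter M F
  · rintro ⟨R, T⟩ hp
    simp only [Finset.mem_product, Finset.mem_powerset] at hp
    have hR : ∀ e ∈ R, e ∉ F := fun e he => (Finset.mem_sdiff.1 (hp.1 he)).2
    ext e
    · simp only [Finset.mem_sdiff, Finset.mem_union]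
      have := hR e
      have := @hp.2 e
      tauto
    · simp only [Finset.mem_inter, Finset.mem_union]
      have := hR e
      have := @hp.2 e
      tauto
  · intro M _
    simp only [Finset.sdiff_union_inter]

/-- The law of a random matching contained in the finite set `F` of edges. -/
noncomputable def finiteMeasure (G : SimpleGraph V) (lam : ℝ) (F : Finset G.edgeSet) :
    Measure (Config G) :=
  ∑ M ∈ F.powerset, ENNReal.ofReal
    ((if IsMatching G (M : Set G.edgeSet) then lam ^ M.card else 0) / matchingSum G lam F) •
      Measure.dirac (configOf M)

theorem isProbabilityMeasure_finiteMeasure (hlam : 0 < lam) (F : Finset G.edgeSet) :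
    IsProbabilityMeasure (finiteMeasure G lam F) := by
  have hZ := matchingSum_pos (G := G) hlam F
  refine ⟨?_⟩
  simp only [finiteMeasure, Measure.coe_finsetSum, Finset.sum_apply, Measure.smul_apply,
    measure_univ, smul_eq_mul, mul_one]
  rw [← ENNReal.ofReal_sum_of_nonneg, ← Finset.sum_div]
  · rw [← matchingSum, div_self hZ.ne', ENNReal.ofReal_one]
  · intro M _
    split_ifs <;> positivity

theorem integral_finiteMeasure (hlam : 0 < lam) (F : Finset G.edgeSet) {f : Config G → ℝ}
    (hf : StronglyMeasurable f) (hfb : ∃ C, ∀ σ, ‖f σ‖ ≤ C) :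
    ∫ σ, f σ ∂finiteMeasure G lam F = (∑ M ∈ F.powerset,
      (if IsMatching G (M : Set G.edgeSet) then lam ^ M.card else 0) * f (configOf M)) /
        matchingSum G lam F := by
  have hZ := matchingSum_pos (G := G) hlam F
  obtain ⟨C, hC⟩ := hfb
  rw [finiteMeasure, integral_finsetSum_measure, Finset.sum_div]
  · refine Finset.sum_congr rfl fun M _ => ?_
    rw [integral_smul_measure, integral_dirac' _ _ hf, ENNReal.toReal_ofReal, smul_eq_mul,
      div_mul_eq_mul_div]
    split_ifs <;> positivity
  · intro M _
    refine Integrable.smul_measure ?_ ENNReal.ofReal_ne_top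
    exact Integrable.of_bound hf.aestronglyMeasurable C (ae_of_all _ hC)

theorem continuous_of_finite_dependence {f : Config G → ℝ} (B : Finset G.edgeSet)
    (h : ∀ σ τ : Config G, (∀ e ∈ B, σ e = τ e) → f σ = f τ) : Continuous f := by
  -- Factor through finitely many discrete coordinates; the value `false` elsewhere is arbitrary.
  have hf : f = (fun τ : B → Bool => f fun e => if he : e ∈ B then τ ⟨e, he⟩ else false) ∘
      fun σ e => σ e := by
    funext σ
    refine h _ _ fun e he => ?_
    simp [he]
  rw [hf]
  exact continuous_of_discreteTopology.comp (by fun_prop)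

theorem finiteGibbs_mem_Icc (hlam : 0 < lam) {F S : Finset G.edgeSet} (hS : S ⊆ F)
    (σ : Config G) : finiteGibbs G lam F S σ ∈ Set.Icc 0 1 := by
  have hpos := sum_weight_pos hlam F σ
  refine ⟨div_nonneg (weight_nonneg hlam F S σ) hpos.le, div_le_one_of_le₀ ?_ hpos.le⟩
  exact Finset.single_le_sum (fun T _ => weight_nonneg hlam F T σ) (Finset.mem_powerset.2 hS)

theorem continuous_finiteGibbs (hΔ : DegreeLE G Δ) {F S : Finset G.edgeSet} (hS : S ⊆ F) :
    Continuous (finiteGibbs G lam F S) := by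
  obtain ⟨C, -, hC⟩ := hΔ.exists_finset_adj F
  refine continuous_of_finite_dependence C fun σ τ h => finiteGibbs_congr (fun e _ hadj => ?_) hS
  obtain ⟨e', he', hadj⟩ := hadj
  exact h e (hC e' he' e hadj)

theorem continuous_indicator_avoiding (A : Finset G.edgeSet) :
    Continuous ((avoiding A).indicator (1 : Config G → ℝ)) := by
  refine continuous_of_finite_dependence A fun σ τ h => ?_
  have : σ ∈ avoiding A ↔ τ ∈ avoiding A := forall₂_congr fun e he => by rw [h e he]
  simp only [Set.indicator, this, Pi.one_apply]

theorem continuous_indicator_agreeing (F S : Finset G.edgeSet) :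
    Continuous ((agreeing F S).indicator (1 : Config G → ℝ)) := by
  refine continuous_of_finite_dependence F fun σ τ h => ?_
  have : σ ∈ agreeing F S ↔ τ ∈ agreeing F S := forall₂_congr fun e he => by rw [h e he]
  simp only [Set.indicator, this, Pi.one_apply]

theorem measurable_finiteGibbs (hΔ : DegreeLE G Δ) {F S : Finset G.edgeSet} (hS : S ⊆ F) :
    Measurable[cylinderEvents (F : Set G.edgeSet)ᶜ] (finiteGibbs G lam F S) := by
  obtain ⟨C, -, hC⟩ := hΔ.exists_finset_adj F
  have hf : finiteGibbs G lam F S =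
      (fun τ : (C \ F : Finset G.edgeSet) → Bool => finiteGibbs G lam F S
        fun e => if he : e ∈ C \ F then τ ⟨e, he⟩ else false) ∘ fun σ e => σ e := by
    funext σ
    refine finiteGibbs_congr (fun e he hadj => ?_) hS
    obtain ⟨e', he', hadj⟩ := hadj
    simp [he, hC e' he' e hadj]
  rw [hf]
  refine Measurable.comp (measurable_of_countable _) ?_
  refine @measurable_pi_lambda _ _ _ (cylinderEvents (F : Set G.edgeSet)ᶜ) _ _ fun e => ?_
  exact measurable_cylinderEvent_apply (by simpa using (Finset.mem_sdiff.1 e.2).2)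

/-- The spatial Markov property of a weak limit of finite-volume Gibbs measures, on the
generating events. -/
theorem integral_avoiding_eq [Countable G.edgeSet] (hlam : 0 < lam) (hΔ : DegreeLE G Δ)
    {U : Ultrafilter (Finset G.edgeSet)} (hU : (U : Filter (Finset G.edgeSet)) ≤ atTop)
    {ρ : Finset G.edgeSet → ProbabilityMeasure (Config G)}
    (hρ : ∀ F, (ρ F : Measure (Config G)) = finiteMeasure G lam F)
    {μ : ProbabilityMeasure (Config G)} (hμ : Tendsto ρ U (𝓝 μ))
    {F S A : Finset G.edgeSet} (hS : S ⊆ F) (hA : (A : Set G.edgeSet) ⊆ (F : Set G.edgeSet)ᶜ) :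
    ∫ σ, (avoiding A).indicator (1 : Config G → ℝ) σ *
      (finiteGibbs G lam F S σ - (agreeing F S).indicator (1 : Config G → ℝ) σ)
        ∂(μ : Measure (Config G)) = 0 := by
  set f : Config G → ℝ := fun σ => (avoiding A).indicator (1 : Config G → ℝ) σ *
      (finiteGibbs G lam F S σ - (agreeing F S).indicator (1 : Config G → ℝ) σ) with hf
  have hcont : Continuous f := (continuous_indicator_avoiding A).mul
    ((continuous_finiteGibbs hΔ hS).sub (continuous_indicator_agreeing F S))
  let g : BoundedContinuousFunction (Config G) ℝ := BoundedContinuousFunction.mkOfCompact ⟨f, hcont⟩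
  have hlim := (ProbabilityMeasure.tendsto_iff_forall_integral_tendsto.1 hμ) g
  refine tendsto_nhds_unique hlim (tendsto_const_nhds.congr' ?_)
  filter_upwards [hU (eventually_ge_atTop F)] with F' hF'
  change 0 = ∫ σ, f σ ∂(ρ F' : Measure (Config G))
  rw [hρ, integral_finiteMeasure hlam F' hcont.stronglyMeasurable ⟨‖g‖, g.norm_coe_le_norm⟩]
  -- As `A` lies outside `F`, the indicator of `avoiding A` is a function of `M \ F`, so it is an
  -- admissible test function.
  have h := sum_matching_markov hlam hF' hS fun R => if Disjoint R A then (1 : ℝ) else 0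
  have h2 : ∀ M : Finset G.edgeSet, f (configOf M) = (if Disjoint (M \ F) A then (1 : ℝ) else 0) *
      (finiteGibbs G lam F S (configOf M) - if M ∩ F = S then 1 else 0) := by
    intro M
    have h3 : configOf M ∈ avoiding A ↔ Disjoint (M \ F) A := by
      rw [Finset.disjoint_right]
      refine forall₂_congr fun e he => ?_
      have : e ∉ F := hA he
      simp [configOf, this]
    have h4 : configOf M ∈ agreeing F S ↔ M ∩ F = S := by
      rw [Finset.ext_iff]
      refine forall_congr' fun e => ?_
      rw [configOf_eq_true, Finset.mem_inter]
      have := @hS e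
      tauto
    simp only [hf, Set.indicator, h3, h4, Pi.one_apply]
  simp only [h2, h, zero_div]

/-- On a countable graph of bounded degree there is a Gibbs measure. -/
theorem exists_isGibbsMeasure [Countable G.edgeSet] (hlam : 0 < lam) (hΔ : DegreeLE G Δ) :
    ∃ μ : Measure (Config G), IsGibbsMeasure G lam μ := by
  let ρ : Finset G.edgeSet → ProbabilityMeasure (Config G) := fun F =>
    ⟨finiteMeasure G lam F, isProbabilityMeasure_finiteMeasure hlam F⟩
  -- The configuration space is compact, hence so is its space of probability measures, and the
  -- finite-volume measures converge along any ultrafilter.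
  let U : Ultrafilter (Finset G.edgeSet) := Ultrafilter.of atTop
  let P : ProbabilityMeasure (Config G) := (U.map ρ).lim
  have hlim : Tendsto ρ U (𝓝 P) := (U.map ρ).le_nhds_lim
  refine ⟨ProbabilityMeasure.toMeasure P, inferInstance, fun F S hS => ?_⟩
  set μ : Measure (Config G) := ProbabilityMeasure.toMeasure P
  have hm := cylinderEvents_le_pi (X := fun _ : G.edgeSet => Bool) (Δ := (F : Set G.edgeSet)ᶜ)
  have hg_meas := measurable_finiteGibbs (lam := lam) hΔ hS
  have hg_int : Integrable (finiteGibbs G lam F S) μ := by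
    refine Integrable.of_bound (hg_meas.mono hm le_rfl).aestronglyMeasurable 1 (ae_of_all _ ?_)
    intro σ
    have := finiteGibbs_mem_Icc hlam hS σ
    rw [Real.norm_of_nonneg this.1]
    exact this.2
  have hs_int : Integrable ((agreeing F S).indicator fun _ : Config G => (1 : ℝ)) μ :=
    (integrable_const _).indicator (measurableSet_agreeing F S)
  have h0_int := hg_int.sub hs_int
  -- This characterises the conditional expectation; a π-λ argument reduces it to the events
  -- `avoiding A` with `A` outside `F`.
  suffices h : ∀ s, MeasurableSet[cylinderEvents (F : Set G.edgeSet)ᶜ] s →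
      ∫ σ in s, (finiteGibbs G lam F S σ -
        (agreeing F S).indicator (fun _ : Config G => (1 : ℝ)) σ) ∂μ = 0 by
    refine (ae_eq_condExp_of_forall_setIntegral_eq hm hs_int
      (fun s _ _ => hg_int.integrableOn) (fun s hs _ => ?_)
      hg_meas.stronglyMeasurable.aestronglyMeasurable).symm
    have := h s hs
    rwa [integral_sub hg_int.integrableOn hs_int.integrableOn, sub_eq_zero] at this
  have hgen : ∀ A : Finset G.edgeSet, (A : Set G.edgeSet) ⊆ (F : Set G.edgeSet)ᶜ →
      ∫ σ in avoiding A, (finiteGibbs G lam F S σ -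
        (agreeing F S).indicator (fun _ : Config G => (1 : ℝ)) σ) ∂μ = 0 := by
    intro A hA
    rw [← integral_avoiding_eq hlam hΔ (Ultrafilter.of_le atTop) (fun _ => rfl) hlim hS hA,
      ← integral_indicator (measurableSet_avoiding A)]
    congr 1
    funext σ
    by_cases hσ : σ ∈ avoiding A <;> simp [hσ, Pi.one_def]
  have huniv : ∫ σ, (finiteGibbs G lam F S σ -
      (agreeing F S).indicator (fun _ : Config G => (1 : ℝ)) σ) ∂μ = 0 := by
    have h := hgen ∅ (by simp)
    have : avoiding (∅ : Finset G.edgeSet) = Set.univ := by ext; simp [avoiding]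
    rwa [this, setIntegral_univ] at h
  refine MeasurableSpace.induction_on_inter (cylinderEvents_eq_generateFrom _)
    (isPiSystem_avoiding _) ?_ ?_ ?_ ?_
  · simp
  · rintro _ ⟨A, hA, rfl⟩
    exact hgen A hA
  · intro t ht h
    have := integral_add_compl (hm t ht) h0_int
    simp only [Pi.sub_apply] at this
    rw [h, huniv, zero_add] at this
    exact this
  · intro f hd hf h
    have := integral_iUnion (fun i => hm _ (hf i)) hd h0_int.integrableOn
    simp only [Pi.sub_apply] at this
    rw [this]
    simp [h]

end Existence

end MonomerDimer

namespace MonomerDimer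

/-! ### Transfer along graph embeddings, and telescoping. -/

section Embedding

open scoped Classical

variable {V W : Type*} {G : SimpleGraph V} {H : SimpleGraph W} {lam : ℝ}

/-- The map on edges induced by a graph embedding. -/
def edgeEmb (f : G ↪g H) : G.lineGraph ↪g H.lineGraph := f.toCopy.toLineGraphEmbedding

theorem coe_edgeEmb (f : G ↪g H) (e : G.edgeSet) :
    (edgeEmb f e : Sym2 W) = (e : Sym2 V).map f := rfl

theorem mem_edgeEmb (f : G ↪g H) (e : G.edgeSet) (v : V) :
    f v ∈ (edgeEmb f e : Sym2 W) ↔ v ∈ (e : Sym2 V) := by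
  rw [coe_edgeEmb, Sym2.mem_map]
  refine ⟨?_, fun h => ⟨v, h, rfl⟩⟩
  rintro ⟨a, ha, hav⟩
  rwa [← f.injective hav]

theorem isMatching_image (f : G ↪g H) (S : Set G.edgeSet) :
    IsMatching H (edgeEmb f '' S) ↔ IsMatching G S := by
  simp only [IsMatching, Set.forall_mem_image, SimpleGraph.Embedding.map_adj_iff]

theorem matchingSum_map (f : G ↪g H) (F : Finset G.edgeSet) :
    matchingSum H lam (F.map (edgeEmb f).toEmbedding) = matchingSum G lam F := by
  rw [matchingSum, Finset.map_eq_image, Finset.powerset_image,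
    Finset.sum_image (f := fun S : Finset H.edgeSet =>
      if IsMatching H (S : Set H.edgeSet) then lam ^ S.card else 0)
      (Finset.image_injective (edgeEmb f).toEmbedding.injective).injOn, matchingSum]
  refine Finset.sum_congr rfl fun S _ => ?_
  rw [Finset.card_image_of_injective _ (edgeEmb f).toEmbedding.injective, Finset.coe_image]
  simp only [← isMatching_image f]
  rfl

theorem vacancy_map (f : G ↪g H) (F : Finset G.edgeSet) (v : V) :
    vacancy H lam (F.map (edgeEmb f).toEmbedding) (f v) = vacancy G lam F v := by
  have : delVertex (F.map (edgeEmb f).toEmbedding) (f v) =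
      (delVertex F v).map (edgeEmb f).toEmbedding := by
    ext e
    simp only [mem_delVertex, Finset.mem_map]
    constructor
    · rintro ⟨⟨e, he, rfl⟩, hv⟩
      exact ⟨e, ⟨he, fun h => hv ((mem_edgeEmb f e v).2 h)⟩, rfl⟩
    · rintro ⟨e, ⟨he, hv⟩, rfl⟩
      exact ⟨⟨e, he, rfl⟩, fun h => hv ((mem_edgeEmb f e v).1 h)⟩
  rw [vacancy, this, matchingSum_map, matchingSum_map, vacancy]

theorem finite_edges_mapsTo (f : G ↪g H) (A : Finset W) :
    {e : G.edgeSet | ∀ w ∈ (e : Sym2 V), f w ∈ A}.Finite := by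
  refine ((A.sym2.finite_toSet).preimage
    ((Sym2.map.injective f.injective).comp Subtype.val_injective).injOn).subset fun e he => ?_
  simp only [Set.mem_preimage, Function.comp_apply, Finset.mem_coe, Finset.mem_sym2_iff,
    Sym2.mem_map]
  rintro _ ⟨a, ha, rfl⟩
  exact he a ha

/-- The edges of `G` whose images under `f` have both ends in the finite set `A` of nodes. -/
noncomputable def edgesInto (f : G ↪g H) (A : Finset W) : Finset G.edgeSet :=
  (finite_edges_mapsTo f A).toFinset

theorem mem_edgesInto {f : G ↪g H} {A : Finset W} {e : G.edgeSet} :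
    e ∈ edgesInto f A ↔ ∀ w ∈ (e : Sym2 V), f w ∈ A := by
  simp [edgesInto]

/-- The edges of `H` with both ends in the finite set `A` of nodes. -/
noncomputable def edgesIn (H : SimpleGraph W) (A : Finset W) : Finset H.edgeSet :=
  edgesInto (SimpleGraph.Embedding.refl : H ↪g H) A

theorem mem_edgesIn {A : Finset W} {e : H.edgeSet} :
    e ∈ edgesIn H A ↔ ∀ w ∈ (e : Sym2 W), w ∈ A := mem_edgesInto

/-- An embedding reflects adjacency, so every edge between nodes in its range comes from `G`. Via
`vacancy_map`, vacancies in finite parts of the lattice become vacancies in the region carrying the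
Gibbs measure. -/
theorem map_edgesInto (f : G ↪g H) (A B : Finset W) (hB : ∀ w, w ∈ B ↔ w ∈ A ∧ w ∈ Set.range f) :
    (edgesInto f A).map (edgeEmb f).toEmbedding = edgesIn H B := by
  ext e
  simp only [Finset.mem_map, mem_edgesInto, mem_edgesIn, hB]
  constructor
  · rintro ⟨e, he, rfl⟩ w hw
    obtain ⟨a, ha, rfl⟩ := Sym2.mem_map.1 hw
    exact ⟨he a ha, a, rfl⟩
  · intro he
    obtain ⟨⟨a, b⟩, hab⟩ := e
    obtain ⟨ha, a, rfl⟩ := he a (Sym2.mem_mk_left a b)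
    obtain ⟨hb, b, rfl⟩ := he _ (Sym2.mem_mk_right _ b)
    refine ⟨⟨s(a, b), f.map_adj_iff.1 hab⟩, ?_, rfl⟩
    intro w hw
    rcases Sym2.mem_iff.1 hw with rfl | rfl <;> assumption

theorem partitionFunction_induce (A : Finset W) :
    partitionFunction (H.induce (A : Set W)) lam = matchingSum H lam (edgesIn H A) := by
  have h := map_edgesInto (SimpleGraph.Embedding.induce (G := H) (A : Set W)) A A
    fun w => ⟨fun hw => ⟨hw, ⟨w, hw⟩, rfl⟩, fun hw => hw.1⟩
  rw [← h, matchingSum_map, matchingSum, partitionFunction]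
  refine Finset.sum_congr ?_ fun _ _ => rfl
  ext S
  simp only [Finset.mem_univ, Finset.mem_powerset, true_iff]
  intro e _
  rw [mem_edgesInto]
  exact fun w _ => w.2

/-- The order is an explicit relation because lattice nodes already carry the pointwise order as an
instance. -/
theorem finset_induction_on_max [DecidableEq W] (r : W → W → Prop) [IsStrictTotalOrder W r]
    {motive : Finset W → Prop} (X : Finset W) (empty : motive ∅)
    (insert : ∀ a X, (∀ x ∈ X, r x a) → motive X → motive (insert a X)) : motive X :=
  @Finset.induction_on_max W (linearOrderOfSTO r) _ _ X empty insert

/-- Telescoping of the partition function when the nodes of `X` are removed one by one, from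
the largest to the smallest. -/
theorem log_matchingSum_telescope [DecidableEq W] (hlam : 0 < lam) (r : W → W → Prop)
    [DecidableRel r] [IsStrictTotalOrder W r]
    (O X : Finset W) (hOX : Disjoint O X) :
    Real.log (matchingSum H lam (edgesIn H (O ∪ X))) =
      Real.log (matchingSum H lam (edgesIn H O)) - ∑ v ∈ X,
        Real.log (vacancy H lam (edgesIn H (O ∪ X.filter fun u => u = v ∨ r u v)) v) := by
  induction X using finset_induction_on_max r with
  | empty => simp
  | insert a X ha ih =>
    have haX : a ∉ X := fun h => irrefl_of r a (ha a h)
    rw [Finset.disjoint_insert_right] at hOX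
    have hfa : (insert a X).filter (fun u => u = a ∨ r u a) = insert a X := by
      refine Finset.filter_true_of_mem fun u hu => ?_
      exact (Finset.mem_insert.1 hu).imp_right fun h => ha u h
    have hfv : ∀ v ∈ X, (insert a X).filter (fun u => u = v ∨ r u v) =
        X.filter fun u => u = v ∨ r u v := by
      intro v hv
      rw [Finset.filter_insert, if_neg]
      have := ha v hv
      rintro (h | h)
      · exact haX (h ▸ hv)
      · exact asymm_of r this h
    rw [Finset.sum_insert haX, hfa, Finset.sum_congr rfl fun v hv => by rw [hfv v hv]]
    have hdel : delVertex (edgesIn H (O ∪ insert a X)) a = edgesIn H (O ∪ X) := by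
      ext e
      simp only [mem_delVertex, mem_edgesIn, Finset.mem_union, Finset.mem_insert]
      constructor
      · rintro ⟨h, hae⟩ w hw
        have : w ≠ a := fun h => hae (h ▸ hw)
        have := h w hw
        tauto
      · intro h
        refine ⟨fun w hw => ?_, fun hae => ?_⟩
        · have := h w hw
          tauto
        · exact (h a hae).elim hOX.1 haX
    rw [vacancy, hdel, Real.log_div (matchingSum_pos hlam _).ne' (matchingSum_pos hlam _).ne']
    linarith [ih hOX.2]

end Embedding

/-! ### Geometry of the lattice: degree, order, parity, boundary. -/

section Lattice

variable {d : ℕ}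

theorem l1norm_add_le (u v : Fin d → ℤ) : l1norm (u + v) ≤ l1norm u + l1norm v := by
  rw [l1norm, l1norm, l1norm, ← Finset.sum_add_distrib]
  exact Finset.sum_le_sum fun j _ => abs_add_le _ _

theorem finite_l1norm_le (r : ℤ) : {v : Fin d → ℤ | l1norm v ≤ r}.Finite := by
  refine (Set.finite_Icc (fun _ => -r) fun _ => r).subset fun v hv => ?_
  have h : ∀ j, |v j| ≤ r := fun j =>
    (Finset.single_le_sum (f := fun j => |v j|) (fun _ _ => abs_nonneg _)
      (Finset.mem_univ j)).trans hv
  exact ⟨fun j => (abs_le.1 (h j)).1, fun j => (abs_le.1 (h j)).2⟩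

theorem adj_iff {u v : Fin d → ℤ} : (lattice d).Adj u v ↔ l1norm (v - u) = 1 := Iff.rfl

/-- The maximal degree of the lattice. -/
noncomputable def latticeDegree (d : ℕ) : ℕ := {v : Fin d → ℤ | l1norm v = 1}.ncard

theorem degreeLE_induce (R : Set (Fin d → ℤ)) :
    DegreeLE ((lattice d).induce R) (latticeDegree d) := by
  intro x
  have hfin : {v : Fin d → ℤ | l1norm v = 1}.Finite :=
    (finite_l1norm_le 1).subset fun v hv => le_of_eq hv
  rw [latticeDegree, hfin.cast_ncard_eq]
  have hinj : Function.Injective fun e : ((lattice d).induce R).edgeSet =>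
      (e : Sym2 R).map Subtype.val :=
    (Sym2.map.injective Subtype.val_injective).comp Subtype.val_injective
  rw [← hinj.encard_image]
  refine (Set.encard_le_encard ?_).trans
    (Set.encard_image_le (fun w => s((x : Fin d → ℤ), x + w)) _)
  rintro _ ⟨⟨e, he⟩, hx, rfl⟩
  obtain ⟨y, rfl⟩ := Sym2.mem_iff_exists.1 hx
  exact ⟨y - x, he, by simp⟩

theorem l1norm_sub_lt_of_mem_near {R : Set (Fin d → ℤ)} (r : ℕ) :
    ∀ x w : R, w ∈ near ((lattice d).induce R) r x → l1norm (w - x : Fin d → ℤ) < r := by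
  induction r with
  | zero => exact fun x w hw => hw.elim
  | succ r ih =>
    rintro x w (hw | hw)
    · rw [Set.mem_singleton_iff.1 hw]
      simp [l1norm]
    · simp only [Set.mem_iUnion] at hw
      obtain ⟨u, hu, hw⟩ := hw
      have h1 : l1norm (u - x : Fin d → ℤ) = 1 := hu
      have h2 := ih u w hw
      have h3 := l1norm_add_le (w - u : Fin d → ℤ) (u - x)
      rw [sub_add_sub_cancel] at h3
      push_cast
      linarith

/-- The translation by `v`, as an embedding of an induced subgraph into the lattice. -/
def translation (R : Set (Fin d → ℤ)) (v : Fin d → ℤ) : (lattice d).induce R ↪g lattice d where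
  toFun x := x + v
  inj' x y h := Subtype.ext (add_right_cancel h)
  map_rel_iff' {x y} := by
    change l1norm ((y.1 + v) - (x.1 + v)) = 1 ↔
      l1norm (y.1 - x.1) = 1
    rw [add_sub_add_right_eq_sub]

theorem translation_apply (R : Set (Fin d → ℤ)) (v : Fin d → ℤ) (x : R) :
    translation R v x = x + v := rfl

theorem prec_sub {u v w : Fin d → ℤ} : Prec (u - w) (v - w) ↔ Prec u v := by
  simp [Prec]

instance isStrictTotalOrder_prec : IsStrictTotalOrder (Fin d → ℤ) Prec where
  irrefl := by
    rintro a ⟨k, hk, -⟩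
    exact lt_irrefl _ hk
  trans := by
    rintro a b c ⟨k, hk, hk'⟩ ⟨l, hl, hl'⟩
    rcases lt_trichotomy k l with h | rfl | h
    · exact ⟨l, by rwa [hk' l h], fun j hj => (hk' j (h.trans hj)).trans (hl' j hj)⟩
    · exact ⟨k, hk.trans hl, fun j hj => (hk' j hj).trans (hl' j hj)⟩
    · exact ⟨k, by rwa [← hl' k h], fun j hj => (hk' j hj).trans (hl' j (h.trans hj))⟩
  trichotomous := by
    intro a b hab hba
    by_contra hne
    have hs : (Finset.univ.filter fun j => a j ≠ b j).Nonempty := by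
      obtain ⟨j, hj⟩ := Function.ne_iff.1 hne
      exact ⟨j, by simpa using hj⟩
    obtain ⟨k, hk, hmax⟩ := (Finset.univ.filter fun j => a j ≠ b j).exists_max_image id hs
    have hk : a k ≠ b k := by simpa using hk
    have heq : ∀ j, k < j → a j = b j := by
      intro j hj
      by_contra h
      exact absurd (hmax j (by simpa using h)) (not_le.2 hj)
    rcases hk.lt_or_gt with h | h
    · exact hab ⟨k, h, heq⟩
    · exact hba ⟨k, h, fun j hj => (heq j hj).symm⟩

theorem sub_mem_below {u v : Fin d → ℤ} : u - v ∈ below d ↔ u = v ∨ Prec u v := by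
  have : Prec (u - v) 0 ↔ Prec u v := by rw [← sub_self v, prec_sub]
  simp only [below, Set.mem_union, Set.mem_singleton_iff, sub_eq_zero]
  rw [Set.mem_ofPred_eq, this, or_comm]

/-- Translation by an even node preserves parity, so the region seen from `v` contains every odd
node, on either side of `v`, and the even nodes up to `v`. -/
theorem sub_mem_belowEven {u v : Fin d → ℤ} (hv : Even (∑ j, v j)) :
    u - v ∈ belowEven d ↔ Odd (∑ j, u j) ∨ u = v ∨ Prec u v := by
  have h1 : Prec 0 (u - v) ↔ Prec v u := by rw [← sub_self v, prec_sub]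
  have h2 : Odd (∑ j, (u - v) j) ↔ Odd (∑ j, u j) := by
    simp only [Pi.sub_apply, Finset.sum_sub_distrib, Int.odd_sub, hv, iff_true]
  rw [belowEven, Set.mem_union, sub_mem_below, Set.mem_ofPred_eq, h1, h2]
  have := trichotomous_of Prec u v
  tauto

theorem even_l1norm_add_sum (v : Fin d → ℤ) : Even (l1norm v + ∑ j, v j) := by
  rw [l1norm, ← Finset.sum_add_distrib]
  refine Finset.even_sum _ fun j _ => ?_
  rcases abs_choice (v j) with h | h <;> simp [h]

theorem odd_sum_add_odd_sum_of_adj {u v : Fin d → ℤ} (h : (lattice d).Adj u v) :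
    Odd (∑ j, v j - ∑ j, u j) := by
  have := even_l1norm_add_sum (v - u)
  rw [adj_iff.1 h] at this
  simp only [Pi.sub_apply, Finset.sum_sub_distrib] at this
  rw [Int.even_add'] at this
  exact this.1 odd_one

/-- A node from which the complement of `A` can be reached in `r` steps is at distance at most
`r` from the boundary of `A`. -/
theorem exists_boundary (A : Finset (Fin d → ℤ)) {v : Fin d → ℤ} (hv : v ∈ A) (r : ℕ) :
    ∀ u ∉ A, l1norm (u - v) ≤ r → ∃ w ∈ boundary A, l1norm (w - v) ≤ r := by
  induction r with
  | zero =>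
    intro u hu h
    refine absurd hv ?_
    have h0 : ∀ j, u j - v j = 0 := by
      intro j
      have := (Finset.single_le_sum (f := fun j => |(u - v) j|) (fun _ _ => abs_nonneg _)
        (Finset.mem_univ j)).trans h
      simpa using this
    have : u = v := funext fun j => by linarith [h0 j]
    rwa [← this]
  | succ r ih =>
    intro u hu h
    have hne : u ≠ v := fun h => hu (h ▸ hv)
    obtain ⟨j, hj⟩ := Function.ne_iff.1 hne
    -- Move `u` one step towards `v`. If this enters `A`, the node reached is on the boundary, with
    -- `u` as outside neighbour; otherwise the induction continues from it.
    set s : ℤ := if u j < v j then 1 else -1 with hs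
    set u' := Function.update u j (u j + s) with hu'
    have hadj : l1norm (u - u') = 1 := by
      rw [l1norm, Finset.sum_eq_single j]
      · rw [Pi.sub_apply, hu', Function.update_self, hs]
        split_ifs <;> simp
      · intro i _ hi
        simp [hu', hi]
      · simp
    have hdist : l1norm (u' - v) + 1 = l1norm (u - v) := by
      rw [l1norm, l1norm, ← Finset.add_sum_erase _ _ (Finset.mem_univ j),
        ← Finset.add_sum_erase _ _ (Finset.mem_univ j)]
      have h1 : ∀ i ∈ Finset.univ.erase j, |(u' - v) i| = |(u - v) i| := by
        intro i hi
        simp [hu', Finset.ne_of_mem_erase hi]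
      rw [Finset.sum_congr rfl h1]
      have h2 : |(u' - v) j| + 1 = |(u - v) j| := by
        rw [Pi.sub_apply, Pi.sub_apply, hu', Function.update_self, hs]
        split_ifs with hlt
        · rw [abs_of_neg (by linarith : u j - v j < 0), abs_of_nonpos (by omega)]
          ring
        · rw [abs_of_pos (by omega : 0 < u j - v j), abs_of_nonneg (by omega)]
          ring
      linarith
    by_cases hmem : u' ∈ A
    · refine ⟨u', ⟨hmem, u, hadj, hu⟩, ?_⟩
      linarith
    · obtain ⟨w, hw, hwv⟩ := ih u' hmem (by push_cast at h; linarith)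
      exact ⟨w, hw, by push_cast; linarith⟩

end Lattice

end MonomerDimer

namespace MonomerDimer

/-! ### The free energy from the cavity probabilities. -/

section FreeEnergy

open scoped Classical

variable {d : ℕ} {lam : ℝ}

/-- The nodes of `A` at distance at most `r` from the complement of `A`. -/
noncomputable def boundaryLayer (A : Finset (Fin d → ℤ)) (r : ℕ) : Finset (Fin d → ℤ) :=
  A.filter fun v => ∃ u ∉ A, l1norm (u - v) ≤ r

theorem finite_boundary (A : Finset (Fin d → ℤ)) : (boundary A).Finite :=
  A.finite_toSet.subset fun _ hv => hv.1

/-- The layer is covered by balls of radius `r` around boundary nodes: it lies in the image of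
boundary × ball under `(w, x) ↦ w - x`. -/
theorem card_boundaryLayer_le (A : Finset (Fin d → ℤ)) (r : ℕ) :
    (boundaryLayer A r).card ≤
      (boundary A).ncard * {v : Fin d → ℤ | l1norm v ≤ r}.ncard := by
  have hfin := (finite_boundary A).prod (finite_l1norm_le (d := d) r)
  rw [← Set.ncard_prod, ← Set.ncard_coe_finset]
  refine (Set.ncard_le_ncard ?_ (hfin.image fun p => p.1 - p.2)).trans (Set.ncard_image_le hfin)
  intro v hv
  obtain ⟨hvA, u, hu, huv⟩ := Finset.mem_filter.1 hv
  obtain ⟨w, hw, hwv⟩ := exists_boundary A hvA r u hu huv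
  exact ⟨(w, w - v), ⟨hw, hwv⟩, sub_sub_cancel w v⟩

/-- Comparison of `log Z_A` with `-|X| log m`, where `m` is the probability that the origin is
unmatched under the Gibbs measure on the region seen by each node of `X` upon its removal. -/
theorem abs_log_matchingSum_add_le (hlam : 0 < lam) {R : Set (Fin d → ℤ)} (h0 : 0 ∈ R)
    {μ : Measure (Config ((lattice d).induce R))} (hμ : IsGibbsMeasure _ lam μ)
    {A O X : Finset (Fin d → ℤ)} (hOX : Disjoint O X) (hA : O ∪ X = A)
    (hX : ∀ v ∈ X, ∀ u ∈ A, (u - v ∈ R ↔ u ∈ O ∨ u = v ∨ Prec u v)) (r : ℕ) :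
    |Real.log (matchingSum (lattice d) lam (edgesIn _ A)) -
        Real.log (matchingSum (lattice d) lam (edgesIn _ O)) +
        X.card * Real.log (μ.real (unmatched _ ⟨0, h0⟩))| ≤
      X.card * decay lam (latticeDegree d) r +
        (boundaryLayer A r).card * Real.log (1 + lam * latticeDegree d) := by
  have hΔ := degreeLE_induce R
  have := hμ.isProbabilityMeasure
  set m := μ.real (unmatched _ ⟨0, h0⟩) with hm
  set K := 1 + lam * latticeDegree d with hK
  have hK1 : 1 ≤ K := by
    have : 0 ≤ lam * latticeDegree d := by positivity
    linarith
  have hlogK := Real.log_nonneg hK1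
  have hd := decay_nonneg hlam (latticeDegree d) r
  have hlog : ∀ x : ℝ, K⁻¹ ≤ x → x ≤ 1 → -Real.log K ≤ Real.log x ∧ Real.log x ≤ 0 := by
    intro x hx hx1
    have hK0 : 0 < K⁻¹ := by positivity
    rw [← Real.log_inv]
    exact ⟨Real.log_le_log hK0 hx, Real.log_nonpos (hK0.trans_le hx).le hx1⟩
  have hterm : ∀ v ∈ X, |Real.log m - Real.log (vacancy (lattice d) lam
      (edgesIn _ (O ∪ X.filter fun u => u = v ∨ Prec u v)) v)| ≤
      decay lam (latticeDegree d) r + if v ∈ boundaryLayer A r then Real.log K else 0 := by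
    intro v hv
    -- By `hX`, the nodes still present when `v` is removed are those of `A` in the translate `R +
    -- v`.
    have hmap := map_edgesInto (translation R v) A (O ∪ X.filter fun u => u = v ∨ Prec u v) (by
      intro w
      have hrange : w ∈ Set.range (translation R v) ↔ w - v ∈ R :=
        ⟨fun ⟨x, hx⟩ => by rw [← hx, translation_apply, add_sub_cancel_right]; exact x.2,
          fun h => ⟨⟨w - v, h⟩, sub_add_cancel w v⟩⟩
      rw [hrange, ← hA, Finset.mem_union, Finset.mem_union, Finset.mem_filter]
      have := hX v hv w
      rw [← hA, Finset.mem_union] at this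
      tauto)
    have hvac := vacancy_map (lam := lam) (translation R v) (edgesInto (translation R v) A) ⟨0, h0⟩
    rw [hmap, translation_apply, zero_add] at hvac
    rw [hvac, abs_sub_comm]
    -- Near the boundary both logarithms lie in `[-log K, 0]`; elsewhere correlation decay applies.
    by_cases hb : v ∈ boundaryLayer A r
    · rw [if_pos hb]
      have h1 := hlog _ (le_vacancy hlam hΔ (edgesInto (translation R v) A) ⟨0, h0⟩)
        (vacancy_le_one hlam _ _)
      have h2 := hlog m (hμ.le_measureReal_unmatched hlam hΔ _) measureReal_le_one
      rw [abs_le]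
      constructor <;> linarith [h1.1, h1.2, h2.1, h2.2]
    · rw [if_neg hb, add_zero]
      refine hμ.abs_log_vacancy_sub_le hlam hΔ _ r _ fun e w hw hwr => ?_
      rw [mem_edgesInto]
      intro x hx
      rw [translation_apply]
      by_contra hxA
      refine hb (Finset.mem_filter.2 ⟨by rw [← hA]; exact Finset.mem_union_right _ hv, _, hxA, ?_⟩)
      rw [add_sub_cancel_right]
      -- An edge touching `near r` has one end at distance less than `r`, hence both at distance at
      -- most `r`: this fixes the width of the layer.
      have h1 := l1norm_sub_lt_of_mem_near r _ _ hwr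
      rw [sub_zero] at h1
      obtain ⟨y, hy⟩ := Sym2.mem_iff_exists.1 hw
      rw [hy, Sym2.mem_iff] at hx
      rcases hx with rfl | rfl
      · exact h1.le
      · have h2 : l1norm (x.1 - w.1) = 1 := by
          have := e.2
          rw [hy] at this
          exact this
        have h3 := l1norm_add_le (x.1 - w.1) w.1
        rw [sub_add_cancel] at h3
        linarith
  have htel := log_matchingSum_telescope (H := lattice d) hlam Prec O X hOX
  rw [hA] at htel
  rw [htel]
  calc _ = |∑ v ∈ X, (Real.log m - Real.log (vacancy (lattice d) lam
        (edgesIn _ (O ∪ X.filter fun u => u = v ∨ Prec u v)) v))| := by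
        rw [Finset.sum_sub_distrib, Finset.sum_const, nsmul_eq_mul]
        ring_nf
    _ ≤ ∑ v ∈ X, (decay lam (latticeDegree d) r +
        if v ∈ boundaryLayer A r then Real.log K else 0) :=
        (Finset.abs_sum_le_sum_abs _ _).trans (Finset.sum_le_sum hterm)
    _ ≤ _ := by
        rw [Finset.sum_add_distrib, Finset.sum_const, nsmul_eq_mul, ← Finset.sum_filter,
          Finset.sum_const, nsmul_eq_mul]
        gcongr
        exact fun v hv => (Finset.mem_filter.1 hv).2

theorem IsExhaustion.card_pos {Λ : ℕ → Finset (Fin d → ℤ)} (hΛ : IsExhaustion Λ) (n : ℕ) :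
    0 < (Λ n).card :=
  Finset.card_pos.2 ⟨0, hΛ.mono (Nat.zero_le n) hΛ.zero_mem⟩

/-- Common core of both formulas: `X` holds the nodes removed in order, `O` those kept. As `O` spans
no edge, its partition function is `1`, and each removal costs about the logarithm of the same
probability. -/
theorem tendsto_log_partitionFunction (hlam : 0 < lam) {R : Set (Fin d → ℤ)} (h0 : 0 ∈ R)
    {μ : Measure (Config ((lattice d).induce R))} (hμ : IsGibbsMeasure _ lam μ)
    {Λ O X : ℕ → Finset (Fin d → ℤ)} (hΛ : IsExhaustion Λ)
    (hOX : ∀ n, Disjoint (O n) (X n)) (hA : ∀ n, O n ∪ X n = Λ n)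
    (hX : ∀ n, ∀ v ∈ X n, ∀ u ∈ Λ n, (u - v ∈ R ↔ u ∈ O n ∨ u = v ∨ Prec u v))
    (hO : ∀ n, edgesIn (lattice d) (O n) = ∅) {α : ℝ}
    (hα : Tendsto (fun n => ((X n).card : ℝ) / (Λ n).card) atTop (𝓝 α)) :
    Tendsto (fun n =>
      Real.log (partitionFunction ((lattice d).induce (Λ n : Set (Fin d → ℤ))) lam) / (Λ n).card)
      atTop (𝓝 (-α * Real.log (μ.real (unmatched _ ⟨0, h0⟩)))) := by
  set L := Real.log (μ.real (unmatched _ ⟨0, h0⟩))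
  set K := Real.log (1 + lam * latticeDegree d)
  have hK : 0 ≤ K := Real.log_nonneg (by
    have : 0 ≤ lam * latticeDegree d := by positivity
    linarith)
  suffices h : Tendsto (fun n =>
      Real.log (matchingSum (lattice d) lam (edgesIn _ (Λ n))) / (Λ n).card +
        (X n).card / (Λ n).card * L) atTop (𝓝 0) by
    have h2 := h.sub (hα.mul_const L)
    simp only [add_sub_cancel_right, zero_sub] at h2
    simpa only [partitionFunction_induce, neg_mul] using h2
  have hbound : ∀ r n, |Real.log (matchingSum (lattice d) lam (edgesIn _ (Λ n))) / (Λ n).card +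
      (X n).card / (Λ n).card * L| ≤ decay lam (latticeDegree d) r +
        (boundary (Λ n)).ncard / (Λ n).card * ({v : Fin d → ℤ | l1norm v ≤ r}.ncard * K) := by
    intro r n
    have hpos : (0 : ℝ) < (Λ n).card := by exact_mod_cast hΛ.card_pos n
    have h1 := abs_log_matchingSum_add_le hlam h0 hμ (hOX n) (hA n) (hX n) r
    rw [hO n, matchingSum_empty, Real.log_one, sub_zero] at h1
    have h2 : ((boundaryLayer (Λ n) r).card : ℝ) ≤
        (boundary (Λ n)).ncard * {v : Fin d → ℤ | l1norm v ≤ r}.ncard := by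
      exact_mod_cast card_boundaryLayer_le (Λ n) r
    have h3 : ((X n).card : ℝ) ≤ (Λ n).card := by
      rw [← hA n]
      exact_mod_cast Finset.card_le_card Finset.subset_union_right
    have hd := decay_nonneg hlam (latticeDegree d) r
    rw [div_mul_eq_mul_div, ← add_div, abs_div, abs_of_pos hpos, div_le_iff₀ hpos]
    refine h1.trans ?_
    calc _ ≤ (Λ n).card * decay lam (latticeDegree d) r +
          ((boundary (Λ n)).ncard * {v : Fin d → ℤ | l1norm v ≤ r}.ncard) * K := by gcongr
      _ = _ := by field_simp
  rw [Metric.tendsto_nhds]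
  intro ε hε
  -- The radius is fixed first to make the decay small; only then does `n` grow, to make the
  -- boundary layer negligible.
  obtain ⟨r, hr⟩ := ((tendsto_decay hlam (latticeDegree d)).eventually
    (gt_mem_nhds (half_pos hε))).exists
  have hb := hΛ.boundary_small.mul_const ({v : Fin d → ℤ | l1norm v ≤ r}.ncard * K)
  rw [zero_mul] at hb
  filter_upwards [hb.eventually (gt_mem_nhds (half_pos hε))] with n hn
  rw [Real.dist_eq, sub_zero]
  linarith [hbound r n]

theorem isFreeEnergy_below (hlam : 0 < lam) {μ : Measure (Config ((lattice d).induce (below d)))}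
    (hμ : IsGibbsMeasure _ lam μ) : IsFreeEnergy d lam
      (-Real.log (μ.real (unmatched _ ⟨0, zero_mem_below d⟩))) := by
  intro Λ hΛ
  have h := tendsto_log_partitionFunction hlam (zero_mem_below d) hμ (O := fun _ => ∅) (X := Λ) hΛ
    (fun n => Finset.disjoint_empty_left _) (fun n => Finset.empty_union _)
    (fun n v _ u _ => by simp [sub_mem_below]) (fun n => ?_) (α := 1) ?_
  · simpa using h
  · ext e
    obtain ⟨⟨u, v⟩, h⟩ := e
    simp only [mem_edgesIn, Finset.notMem_empty, iff_false]
    exact fun h => h u (Sym2.mem_mk_left u v)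
  · refine tendsto_const_nhds.congr fun n => (div_self ?_).symm
    exact_mod_cast (hΛ.card_pos n).ne'

/-- Translation by a unit vector flips parity and injects the nodes of one parity class that stay in
`A` into the other; those that leave `A` are boundary nodes. This needs a direction to move in, so
`0 < d`. -/
theorem abs_two_mul_card_even_sub_le (hd : 0 < d) (A : Finset (Fin d → ℤ)) :
    |2 * ((A.filter fun v => Even (∑ j, v j)).card : ℝ) - A.card| ≤ (boundary A).ncard := by
  set t : Fin d → ℤ := Pi.single ⟨0, hd⟩ 1
  have ht : ∑ j, t j = 1 := by simp [t]
  have htn : l1norm t = 1 := by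
    rw [l1norm, Finset.sum_eq_single ⟨0, hd⟩] <;> simp +contextual [t]
  have key : ∀ (p q : (Fin d → ℤ) → Prop) [DecidablePred p] [DecidablePred q],
      (∀ v, p v → q (v + t)) →
      (A.filter p).card ≤ (A.filter q).card + (boundary A).ncard := by
    intro p q _ _ hpq
    have hsub : A.filter p ⊆ (A.filter fun v => p v ∧ v + t ∈ A) ∪ (finite_boundary A).toFinset := by
      intro v hv
      rw [Finset.mem_filter] at hv
      rw [Finset.mem_union, Finset.mem_filter, Set.Finite.mem_toFinset]
      by_cases h : v + t ∈ A
      · exact Or.inl ⟨hv.1, hv.2, h⟩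
      · exact Or.inr ⟨hv.1, v + t, by rw [adj_iff, add_sub_cancel_left, htn], h⟩
    have h1 := (Finset.card_le_card hsub).trans (Finset.card_union_le _ _)
    rw [← Set.ncard_eq_toFinset_card _ (finite_boundary A)] at h1
    refine h1.trans (Nat.add_le_add_right ?_ _)
    refine Finset.card_le_card_of_injOn (· + t) (fun v hv => ?_) (add_left_injective t).injOn
    have := (Finset.mem_filter.1 hv).2
    exact Finset.mem_coe.2 (Finset.mem_filter.2 ⟨this.2, hpq v this.1⟩)
  have h1 := key (fun v => Even (∑ j, v j)) (fun v => ¬ Even (∑ j, v j)) fun v hv => by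
    simp only [Pi.add_apply, Finset.sum_add_distrib, ht, Int.not_even_iff_odd]
    exact hv.add_one
  have h2 := key (fun v => ¬ Even (∑ j, v j)) (fun v => Even (∑ j, v j)) fun v hv => by
    simp only [Pi.add_apply, Finset.sum_add_distrib, ht]
    exact (Int.not_even_iff_odd.1 hv).add_one
  have h3 := Finset.card_filter_add_card_filter_not (s := A) fun v => Even (∑ j, v j)
  have h1' : ((A.filter fun v => Even (∑ j, v j)).card : ℝ) ≤
    (A.filter fun v => ¬ Even (∑ j, v j)).card + (boundary A).ncard := by exact_mod_cast h1
  have h2' : ((A.filter fun v => ¬ Even (∑ j, v j)).card : ℝ) ≤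
    (A.filter fun v => Even (∑ j, v j)).card + (boundary A).ncard := by exact_mod_cast h2
  have h3' : ((A.filter fun v => Even (∑ j, v j)).card : ℝ) +
    (A.filter fun v => ¬ Even (∑ j, v j)).card = A.card := by exact_mod_cast h3
  rw [abs_le]
  constructor <;> linarith

theorem isFreeEnergy_belowEven (hd : 0 < d) (hlam : 0 < lam)
    {ν : Measure (Config ((lattice d).induce (belowEven d)))}
    (hν : IsGibbsMeasure _ lam ν) : IsFreeEnergy d lam
      (-(1 / 2) * Real.log (ν.real (unmatched _ ⟨0, zero_mem_belowEven d⟩))) := by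
  intro Λ hΛ
  refine tendsto_log_partitionFunction hlam (zero_mem_belowEven d) hν
    (O := fun n => (Λ n).filter fun v => ¬ Even (∑ j, v j))
    (X := fun n => (Λ n).filter fun v => Even (∑ j, v j)) hΛ
    (fun n => (Finset.disjoint_filter_filter_not _ _ _).symm)
    (fun n => (Finset.union_comm _ _).trans (Finset.filter_union_filter_not_eq _ _))
    (fun n v hv u hu => ?_) (fun n => ?_) ?_
  · rw [sub_mem_belowEven (Finset.mem_filter.1 hv).2, Finset.mem_filter, Int.not_even_iff_odd]
    simp [hu]
  · rw [Finset.eq_empty_iff_forall_notMem]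
    rintro ⟨⟨u, v⟩, huv⟩ h
    rw [mem_edgesIn] at h
    have hu := Int.not_even_iff_odd.1 (Finset.mem_filter.1 (h u (Sym2.mem_mk_left u v))).2
    have hv := Int.not_even_iff_odd.1 (Finset.mem_filter.1 (h v (Sym2.mem_mk_right u v))).2
    exact Int.not_even_iff_odd.2 (odd_sum_add_odd_sum_of_adj huv) (hv.sub_odd hu)
  · rw [tendsto_iff_norm_sub_tendsto_zero]
    refine squeeze_zero (fun n => norm_nonneg _) (fun n => ?_) hΛ.boundary_small
    have hpos : (0 : ℝ) < (Λ n).card := by exact_mod_cast hΛ.card_pos n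
    have h := abs_two_mul_card_even_sub_le hd (Λ n)
    have hb : (0 : ℝ) ≤ (boundary (Λ n)).ncard := by positivity
    rw [abs_le] at h
    rw [Real.norm_eq_abs, le_div_iff₀ hpos, ← abs_of_pos hpos, ← abs_mul, abs_of_pos hpos, sub_mul,
      div_mul_cancel₀ _ hpos.ne', abs_le]
    constructor <;> linarith

/-! ### Boxes as an admissible sequence, and the conclusion. -/

/-- The box `[-n, n]^d`. -/
noncomputable def box (d n : ℕ) : Finset (Fin d → ℤ) := Finset.Icc (fun _ => -(n : ℤ)) fun _ => (n : ℤ)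

theorem mem_box {n : ℕ} {v : Fin d → ℤ} : v ∈ box d n ↔ ∀ j, |v j| ≤ n := by
  simp only [box, Finset.mem_Icc, Pi.le_def, abs_le, forall_and]

theorem card_box (d n : ℕ) : (box d n).card = (2 * n + 1) ^ d := by
  rw [box, Pi.card_Icc]
  simp only [Int.card_Icc, Finset.prod_const, Finset.card_univ, Fintype.card_fin]
  congr 1
  omega

theorem box_mono : Monotone (box d) := fun m n h v hv => by
  rw [mem_box] at hv ⊢
  exact fun j => (hv j).trans (by exact_mod_cast h)

theorem abs_apply_le_l1norm (v : Fin d → ℤ) (j : Fin d) : |v j| ≤ l1norm v :=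
  Finset.single_le_sum (f := fun j => |v j|) (fun _ _ => abs_nonneg _) (Finset.mem_univ j)

theorem ncard_boundary_box_le (d n : ℕ) :
    ((boundary (box d (n + 1))).ncard : ℝ) ≤ (box d (n + 1)).card - (box d n).card := by
  have hsub : boundary (box d (n + 1)) ⊆ ((box d (n + 1) \ box d n : Finset _) : Set _) := by
    rintro v ⟨hv, u, huv, hu⟩
    rw [Finset.mem_coe, Finset.mem_sdiff]
    refine ⟨hv, fun h => hu ?_⟩
    rw [mem_box] at h ⊢
    intro j
    have h1 := (abs_apply_le_l1norm (u - v) j).trans_eq (adj_iff.1 huv)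
    have h2 := abs_add_le (u j - v j) (v j)
    rw [sub_add_cancel] at h2
    have h3 := h j
    rw [Pi.sub_apply] at h1
    push_cast
    linarith
  have h := Set.ncard_le_ncard hsub (Finset.finite_toSet _)
  rw [Set.ncard_coe_finset, Finset.card_sdiff_of_subset (box_mono n.le_succ)] at h
  rw [← Nat.cast_sub (Finset.card_le_card (box_mono n.le_succ))]
  exact_mod_cast h

/-- At least one admissible sequence is needed: the two expressions are identified as limits of the
same quantity along it. -/
theorem isExhaustion_box (d : ℕ) : IsExhaustion (box d) where
  zero_mem := by simp [mem_box]
  mono := box_mono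
  ball_subset r := by
    filter_upwards [eventually_ge_atTop r] with n hn v hv
    rw [mem_box]
    intro j
    have := abs_apply_le_l1norm v j
    omega
  boundary_small := by
    rw [← tendsto_add_atTop_iff_nat 1]
    have hlim : Tendsto (fun n : ℕ => 1 - (1 - 2 / (2 * (n : ℝ) + 3)) ^ d) atTop (𝓝 0) := by
      have h1 : Tendsto (fun n : ℕ => 2 / (2 * (n : ℝ) + 3)) atTop (𝓝 0) := by
        refine Tendsto.const_div_atTop ?_ 2
        refine tendsto_atTop_add_const_right _ _ ?_
        exact tendsto_natCast_atTop_atTop.const_mul_atTop two_pos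
      have h2 := ((h1.const_sub 1).pow d).const_sub 1
      simpa using h2
    refine squeeze_zero (fun n => by positivity) (fun n => ?_) hlim
    have hpos : (0 : ℝ) < 2 * n + 3 := by positivity
    have hcard : ((box d (n + 1)).card : ℝ) = (2 * n + 3) ^ d := by
      rw [card_box]
      push_cast
      ring
    have hcard' : ((box d n).card : ℝ) = (2 * n + 1) ^ d := by
      rw [card_box]
      push_cast
      ring
    have h := ncard_boundary_box_le d n
    rw [hcard, hcard'] at h
    rw [hcard, div_le_iff₀ (by positivity)]
    refine h.trans_eq ?_
    rw [sub_mul, ← mul_pow, one_mul]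
    congr 2
    field_simp
    ring

theorem unmatched_eq_univ_of_dim_zero (R : Set (Fin 0 → ℤ)) (v : R) :
    unmatched ((lattice 0).induce R) v = Set.univ := by
  refine Set.eq_univ_of_forall fun σ e => ?_
  obtain ⟨⟨a, b⟩, hab⟩ := e
  exact (((SimpleGraph.mem_edgeSet _).1 hab).ne (Subsingleton.elim a b)).elim

theorem existsUnique_isGibbsMeasure (hlam : 0 < lam) (R : Set (Fin d → ℤ)) :
    ∃! μ : Measure (Config ((lattice d).induce R)), IsGibbsMeasure _ lam μ := by
  have : Countable (Sym2 R) := inferInstanceAs (Countable (Quot _))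
  obtain ⟨μ, hμ⟩ := exists_isGibbsMeasure hlam (degreeLE_induce R)
  exact ⟨μ, hμ, fun ν hν => hν.unique hlam (degreeLE_induce R) hμ⟩

end FreeEnergy

end MonomerDimer

theorem corollary4 (d : ℕ) (lam : ℝ) (hlam : 0 < lam) :
    (∃! μ : Measure (MonomerDimer.Config
        ((MonomerDimer.lattice d).induce (MonomerDimer.below d))),
      MonomerDimer.IsGibbsMeasure _ lam μ) ∧
    (∃! ν : Measure (MonomerDimer.Config
        ((MonomerDimer.lattice d).induce (MonomerDimer.belowEven d))),
      MonomerDimer.IsGibbsMeasure _ lam ν) ∧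
    ∀ (μ : Measure (MonomerDimer.Config
        ((MonomerDimer.lattice d).induce (MonomerDimer.below d))))
      (ν : Measure (MonomerDimer.Config
        ((MonomerDimer.lattice d).induce (MonomerDimer.belowEven d)))),
      MonomerDimer.IsGibbsMeasure _ lam μ → MonomerDimer.IsGibbsMeasure _ lam ν →
      0 < μ.real (MonomerDimer.unmatched _ ⟨0, MonomerDimer.zero_mem_below d⟩) ∧
      0 < ν.real (MonomerDimer.unmatched _ ⟨0, MonomerDimer.zero_mem_belowEven d⟩) ∧
      ∃ P : ℝ, MonomerDimer.IsFreeEnergy d lam P ∧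
        P = -Real.log
          (μ.real (MonomerDimer.unmatched _ ⟨0, MonomerDimer.zero_mem_below d⟩)) ∧
        P = -(1 / 2) * Real.log
          (ν.real (MonomerDimer.unmatched _ ⟨0, MonomerDimer.zero_mem_belowEven d⟩)) := by
  refine ⟨MonomerDimer.existsUnique_isGibbsMeasure hlam _,
    MonomerDimer.existsUnique_isGibbsMeasure hlam _, fun μ ν hμ hν => ?_⟩
  have hpos : 0 < (1 + lam * MonomerDimer.latticeDegree d)⁻¹ := by positivity
  refine ⟨hpos.trans_le (hμ.le_measureReal_unmatched hlam (MonomerDimer.degreeLE_induce _) _),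
    hpos.trans_le (hν.le_measureReal_unmatched hlam (MonomerDimer.degreeLE_induce _) _),
    _, MonomerDimer.isFreeEnergy_below hlam hμ, rfl, ?_⟩
  -- For `d = 0` the single node is even, so the density `1/2` fails; but there are no edges, both
  -- probabilities are `1`, and both logarithms vanish.
  rcases Nat.eq_zero_or_pos d with rfl | hd
  · have := hμ.isProbabilityMeasure
    have := hν.isProbabilityMeasure
    rw [MonomerDimer.unmatched_eq_univ_of_dim_zero, MonomerDimer.unmatched_eq_univ_of_dim_zero]
    simp
  · exact tendsto_nhds_unique
      (MonomerDimer.isFreeEnergy_below hlam hμ _ (MonomerDimer.isExhaustion_box d))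
      (MonomerDimer.isFreeEnergy_belowEven hd hlam hν _ (MonomerDimer.isExhaustion_box d))
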